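/- **Setting.** Let $n\ge 2$ and let $\Omega\subset\mathbb R^n$ be a bounded domain with Lipschitz boundary. Let $\mathcal E_1,\dots,\mathcal E_m\subset\partial\Omega$ ($m\ge 1$) be nonempty, connected, relatively open sets (electrodes) with pairwise disjoint closures; electrode indices are taken modulo $m$. Let $\sigma_0\in L^\infty_+(\Omega)$ (essentially bounded, with positive essential infimum) have the unique continuation property: every $u\in H^1(\Omega)$ with $\nabla\cdot(\sigma_0\nabla u)=0$ in $\Omega$ that is constant on a nonempty open subset of $\Omega$ is constant on $\Omega$. For $k=1,\dots,m$ let $u^{(k)}=u^{(k)}_{\sigma_0}\in H^1(\Omega)$ be the (weak) solution, unique up to an additive constant, of the shunt electrode model $$\nabla\cdot(\sigma_0\nabla u)=0\ \text{in }\Omega,\qquad \int_{\mathcal E_l}\sigma_0\partial_\nu u\,ds=\delta_{k,l}-\delta_{k+1,l},\qquad \sigma_0\partial_\nu u=0\ \text{on }\partial\Omega\setminus\bigcup_l\mathcal E_l,\qquad u|_{\mathcal E_l}=\text{const.}\quad(l=1,\dots,m).$$ Let the closure $\overline\Omega=\bigcup_{i=1}^r P_i$ be partitioned into finitely many measurable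 pixels $P_i$, disjoint up to null sets, and let $B\subseteq\Omega$ be a closed set with nonempty interior which is a union of pixels, $B=\bigcup_{P_i\subseteq B}P_i$. Let $S_B\in\mathbb R^{m\times m}$ be the summed sensitivity matrix, $$S_B=\sum_{i:\,P_i\subseteq B}S_i,\qquad (S_i)_{jk}=-\int_{P_i}\nabla u^{(j)}\cdot\nabla u^{(k)}\,dx,$$ and let $S_B^+$ be its Moore–Penrose pseudoinverse. Let $V\in\mathbb R^{m\times m}$ be a data matrix with $V_{jk}=V_{kj}$ for $|j-k|>1$ (modulo $m$); its entries with $|j-k|\le 1$ (voltages on current-driven electrodes) are arbitrary. A matrix $W\in\mathbb R^{m\times m}$ is said to satisfy the *constraints* if $$W_{jk}=V_{jk}\ \text{ for } |j-k|>1 \text{ (modulo } m),\qquad \sum_{j=1}^m W_{jk}=0\ \text{ for all }k,\qquad W_{j,j-1}=W_{j-1,j}\ \text{ for all } j.$$ Source terms $F^{(1)},\dots,F^{(m)}\in L^2(B)^n$ produce the matrix $W$ with entries $W_{jk}=v^{(k)}|_{\mathcal E_j}-v^{(k)}|_{\mathcal E_{j+1}}$, where $v^{(k)}\in H^1(\Omega)$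 is the (weak) solution, unique up to an additive constant, of $$\nabla\cdot(\sigma_0\nabla v)=\nabla\cdot F^{(k)}\ \text{in }\Omega,\qquad \int_{\mathcal E_l}\sigma_0\partial_\nu v\,ds=0,\qquad \sigma_0\partial_\nu v=0\ \text{on }\partial\Omega\setminus\bigcup_l\mathcal E_l,\qquad v|_{\mathcal E_l}=\text{const.}\quad(l=1,\dots,m),$$ and they are *measurement-consistent* if $W$ satisfies the constraints. A *geometrically interpolated measurement matrix* is a matrix produced by measurement-consistent source terms that minimize $\sum_{j=1}^m\|F^{(j)}\|^2_{L^2(B)^n}$ among all measurement-consistent source terms. **Theorem.** The solutions $u^{(k)}$ exist, and there exists a unique geometrically interpolated measurement matrix $V^{\mathrm{geom}}\in\mathbb R^{m\times m}$. It satisfies the constraints, and it is the unique minimizer of $$W\mapsto-\sum_{j=1}^m e_j^T W^T S_B^+ W e_j$$ among all $W\in\mathbb R^{m\times m}$ that satisfy the constraints, where $e_j\in\mathbb R^m$ is the $j$-th unit vector. -/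

import Mathlib

open MeasureTheory Filter Topology
open scoped ContDiff

noncomputable section

namespace EIT

/-- The Euclidean space `ℝⁿ`. -/
abbrev Space (n : ℕ) : Type := EuclideanSpace ℝ (Fin n)

section Sobolev

variable {n : ℕ}

/-- `Ω` is a bounded domain with Lipschitz boundary: near every boundary point, for a suitable
unit vector `e`, the set `Ω` is the strict epigraph in direction `e` of a Lipschitz function
`γ` of the component of the point that is orthogonal to `e`. -/
structure IsBoundedLipschitzDomain (Ω : Set (Space n)) : Prop where
  isOpen : IsOpen Ω
  isConnected : IsConnected Ω
  isBounded : Bornology.IsBounded Ω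
  lipschitz_boundary : ∀ x ∈ frontier Ω, ∃ (U : Set (Space n)) (e : Space n)
    (K : NNReal) (γ : Space n → ℝ), IsOpen U ∧ x ∈ U ∧ ‖e‖ = 1 ∧ LipschitzWith K γ ∧
      ∀ y ∈ U, y ∈ Ω ↔ γ (y - inner ℝ e y • e) < inner ℝ e y

/-- `u ∈ H¹(Ω)` with weak gradient `G ∈ L²(Ω)ⁿ`. -/
structure IsH1 (Ω : Set (Space n)) (u : Space n → ℝ) (G : Space n → Space n) : Prop where
  memLp : MemLp u 2 (volume.restrict Ω)
  memLp_grad : MemLp G 2 (volume.restrict Ω)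
  weak_grad : ∀ φ : Space n → ℝ, ContDiff ℝ ∞ φ → HasCompactSupport φ → tsupport φ ⊆ Ω →
    ∫ x in Ω, u x • gradient φ x = - ∫ x in Ω, φ x • G x

/-- The surface measure on `∂Ω`: the `(n-1)`-dimensional Hausdorff measure (its
normalization does not matter here). -/
def surfaceMeasure (Ω : Set (Space n)) : Measure (Space n) :=
  (Measure.hausdorffMeasure ((n : ℝ) - 1)).restrict (frontier Ω)

/-- `g ∈ L²(∂Ω)` is the boundary trace of the `H¹(Ω)`-function `u` with weak gradient `G`, i.e.
the value at `u` of the continuous extension to `H¹(Ω)` of the restriction map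
`φ ↦ φ|_∂Ω`, from smooth functions to `L²(∂Ω)`. -/
def HasTrace (Ω : Set (Space n)) (u : Space n → ℝ) (G : Space n → Space n)
    (g : Space n → ℝ) : Prop :=
  MemLp g 2 (surfaceMeasure Ω) ∧
  ∃ φ : ℕ → Space n → ℝ, (∀ i, ContDiff ℝ ∞ (φ i)) ∧
    Tendsto (fun i => eLpNorm (fun x => φ i x - u x) 2 (volume.restrict Ω)) atTop (𝓝 0) ∧
    Tendsto (fun i => eLpNorm (fun x => gradient (φ i) x - G x) 2 (volume.restrict Ω))
      atTop (𝓝 0) ∧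
    Tendsto (fun i => eLpNorm (fun x => φ i x - g x) 2 (surfaceMeasure Ω)) atTop (𝓝 0)

/-- `σ ∈ L^∞_+(Ω)`: essentially bounded with positive essential infimum. -/
def IsConductivity (Ω : Set (Space n)) (σ : Space n → ℝ) : Prop :=
  MemLp σ ⊤ (volume.restrict Ω) ∧ ∃ c : ℝ, 0 < c ∧ ∀ᵐ x ∂(volume.restrict Ω), c ≤ σ x

/-- The unique continuation property: an `H¹(Ω)`-solution of `∇ ⬝ (σ ∇u) = 0` in `Ω` that is
constant on a nonempty open subset of `Ω` is constant on all of `Ω`. -/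
def UCP (Ω : Set (Space n)) (σ : Space n → ℝ) : Prop :=
  ∀ (u : Space n → ℝ) (G : Space n → Space n), IsH1 Ω u G →
    (∀ φ : Space n → ℝ, ContDiff ℝ ∞ φ → HasCompactSupport φ → tsupport φ ⊆ Ω →
      ∫ x in Ω, σ x * inner ℝ (G x) (gradient φ x) = 0) →
    ∀ O : Set (Space n), IsOpen O → O.Nonempty → O ⊆ Ω →
      (∃ c : ℝ, ∀ᵐ x ∂(volume.restrict O), u x = c) →
      ∃ c : ℝ, ∀ᵐ x ∂(volume.restrict Ω), u x = c

end Sobolev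

section ShuntModel

variable {n m : ℕ}

/-- Electrodes: nonempty, connected, relatively open subsets of `∂Ω` with pairwise disjoint
closures. -/
structure IsElectrodes (Ω : Set (Space n)) (E : Fin m → Set (Space n)) : Prop where
  isConnected : ∀ l, IsConnected (E l)
  relatively_open : ∀ l, ∃ O : Set (Space n), IsOpen O ∧ E l = O ∩ frontier Ω
  disjoint : Pairwise fun l k => Disjoint (closure (E l)) (closure (E k))

/-- `u ∈ H¹(Ω)`, with weak gradient `G`, is constant on each electrode, with value `c l` on the
electrode `E l`. -/
structure IsElectrodePotential (Ω : Set (Space n)) (E : Fin m → Set (Space n))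
    (u : Space n → ℝ) (G : Space n → Space n) (c : Fin m → ℝ) : Prop where
  isH1 : IsH1 Ω u G
  trace_const : ∃ g : Space n → ℝ, HasTrace Ω u G g ∧
    ∀ l, ∀ᵐ x ∂((surfaceMeasure Ω).restrict (E l)), g x = c l

/-- `u ∈ H¹(Ω)`, with weak gradient `G` and electrode voltages `c`, is the (weak) solution of the
shunt model with conductivity `σ` and electrode currents `I`:
`∇ ⬝ (σ ∇u) = 0` in `Ω`, `∫_{E l} σ ∂_ν u = I l`, `σ ∂_ν u = 0` on `∂Ω` off the electrodes,
`u|_{E l} = const`. -/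
structure IsShuntSolution (Ω : Set (Space n)) (E : Fin m → Set (Space n)) (σ : Space n → ℝ)
    (I : Fin m → ℝ) (u : Space n → ℝ) (G : Space n → Space n) (c : Fin m → ℝ) : Prop where
  potential : IsElectrodePotential Ω E u G c
  weak : ∀ (w : Space n → ℝ) (W : Space n → Space n) (d : Fin m → ℝ),
    IsElectrodePotential Ω E w W d →
      ∫ x in Ω, σ x * inner ℝ (G x) (W x) = ∑ l, I l * d l

/-- `v ∈ H¹(Ω)`, with weak gradient `G` and electrode voltages `c`, is the (weak) solution of
`∇ ⬝ (σ ∇v) = ∇ ⬝ F` in `Ω` with the source `F ∈ L²(B)ⁿ` extended by zero, and with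
`∫_{E l} σ ∂_ν v = 0`, `σ ∂_ν v = 0` on `∂Ω` off the electrodes, `v|_{E l} = const`. -/
structure IsSourceSolution (Ω : Set (Space n)) (E : Fin m → Set (Space n)) (σ : Space n → ℝ)
    (B : Set (Space n)) (F : Space n → Space n)
    (v : Space n → ℝ) (G : Space n → Space n) (c : Fin m → ℝ) : Prop where
  potential : IsElectrodePotential Ω E v G c
  weak : ∀ (w : Space n → ℝ) (W : Space n → Space n) (d : Fin m → ℝ),
    IsElectrodePotential Ω E w W d →
      ∫ x in Ω, σ x * inner ℝ (G x) (W x) = ∫ x in B, inner ℝ (F x) (W x)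

variable [NeZero m]

/-- The `k`-th adjacent driving pattern `I_l = δ_{k,l} - δ_{k+1,l}` (indices modulo `m`). -/
def adjacentCurrent (k l : Fin m) : ℝ :=
  (if k = l then 1 else 0) - (if k + 1 = l then 1 else 0)

/-- `|j - k| > 1` modulo `m`: the electrode pairs `j` and `k` have no electrode in common. -/
def CurrentFree (j k : Fin m) : Prop := j ≠ k ∧ j ≠ k + 1 ∧ k ≠ j + 1

/-- The interpolation, zero column sum and symmetry conditions on `W` for the data `V`. -/
structure Constraints (V W : Matrix (Fin m) (Fin m) ℝ) : Prop where
  interpolation : ∀ j k, CurrentFree j k → W j k = V j k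
  column_sum : ∀ k, ∑ j, W j k = 0
  symmetry : ∀ j, W j (j - 1) = W (j - 1) j

/-- The sources `F⁽¹⁾, …, F⁽ᵐ⁾ ∈ L²(B)ⁿ` are measurement-consistent with the data `V`, and `W` is
the matrix of the measurements constructed from them. -/
structure IsConsistent (Ω : Set (Space n)) (E : Fin m → Set (Space n)) (σ₀ : Space n → ℝ)
    (B : Set (Space n)) (V : Matrix (Fin m) (Fin m) ℝ)
    (F : Fin m → Space n → Space n) (W : Matrix (Fin m) (Fin m) ℝ) : Prop where
  memLp : ∀ k, MemLp (F k) 2 (volume.restrict B)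
  measurement : ∀ k, ∃ (v : Space n → ℝ) (G : Space n → Space n) (c : Fin m → ℝ),
    IsSourceSolution Ω E σ₀ B (F k) v G c ∧ ∀ j, W j k = c j - c (j + 1)
  constraints : Constraints V W

/-- `W` is a geometrically interpolated measurement matrix for the data `V`: it is constructed
from measurement-consistent source terms on `B` with minimal sum of squared `L²`-norms. -/
def IsGeometricInterpolant (Ω : Set (Space n)) (E : Fin m → Set (Space n)) (σ₀ : Space n → ℝ)
    (B : Set (Space n)) (V W : Matrix (Fin m) (Fin m) ℝ) : Prop :=
  ∃ F : Fin m → Space n → Space n, IsConsistent Ω E σ₀ B V F W ∧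
    ∀ (F' : Fin m → Space n → Space n) (W' : Matrix (Fin m) (Fin m) ℝ),
      IsConsistent Ω E σ₀ B V F' W' →
        ∑ j, ∫ x in B, ‖F j x‖ ^ 2 ≤ ∑ j, ∫ x in B, ‖F' j x‖ ^ 2

end ShuntModel

section Sensitivity

variable {n m r : ℕ}

/-- A partition of the closure of `Ω` into pixels, disjoint up to null sets. -/
structure IsPixelPartition (Ω : Set (Space n)) (P : Fin r → Set (Space n)) : Prop where
  measurableSet : ∀ i, MeasurableSet (P i)
  disjoint : Pairwise fun i j => volume (P i ∩ P j) = 0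
  cover : closure Ω = ⋃ i, P i

/-- The sensitivity matrix `S_i` of the pixel `P`, for the potentials with gradients `G j`. -/
def pixelSensitivity (Ω : Set (Space n)) (G : Fin m → Space n → Space n) (P : Set (Space n)) :
    Matrix (Fin m) (Fin m) ℝ :=
  Matrix.of fun j k => - ∫ x in P ∩ Ω, inner ℝ (G j x) (G k x)

open Classical in
/-- The summed sensitivity matrix `S_B`, the sum of `S_i` over all pixels `P i ⊆ B`. -/
def summedSensitivity (Ω : Set (Space n)) (P : Fin r → Set (Space n))
    (B : Set (Space n)) (G : Fin m → Space n → Space n) : Matrix (Fin m) (Fin m) ℝ :=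
  ∑ i with P i ⊆ B, pixelSensitivity Ω G (P i)

end Sensitivity

section PseudoInverse

variable {m : ℕ}

/-- `X` is the Moore-Penrose pseudoinverse of `A`. -/
structure IsMoorePenrose (A X : Matrix (Fin m) (Fin m) ℝ) : Prop where
  mul_mul : A * X * A = A
  mul_mul' : X * A * X = X
  symm_left : (A * X).transpose = A * X
  symm_right : (X * A).transpose = X * A

theorem IsMoorePenrose.unique {A X Y : Matrix (Fin m) (Fin m) ℝ}
    (hX : IsMoorePenrose A X) (hY : IsMoorePenrose A Y) : X = Y := by
  have h1 : A * X = A * Y := by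
    have a : A * X = (A * Y) * (A * X) := by
      rw [← mul_assoc, hY.mul_mul]
    have b : A * Y = (A * X) * (A * Y) := by
      rw [← mul_assoc, hX.mul_mul]
    have c := congrArg Matrix.transpose b
    rw [hY.symm_left, Matrix.transpose_mul, hX.symm_left, hY.symm_left] at c
    rw [a, ← c]
  have h2 : X * A = Y * A := by
    have a : X * A = (X * A) * (Y * A) := by
      rw [mul_assoc, ← mul_assoc A, hY.mul_mul]
    have b : Y * A = (Y * A) * (X * A) := by
      rw [mul_assoc, ← mul_assoc A, hX.mul_mul]
    have c := congrArg Matrix.transpose b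
    rw [hY.symm_right, Matrix.transpose_mul, hX.symm_right, hY.symm_right] at c
    rw [a, ← c]
  calc X = X * A * X := hX.mul_mul'.symm
    _ = Y * (A * X) := by rw [h2, mul_assoc]
    _ = Y := by rw [h1, ← mul_assoc, hY.mul_mul']

theorem IsMoorePenrose.transpose {A X : Matrix (Fin m) (Fin m) ℝ} (h : IsMoorePenrose A X) :
    IsMoorePenrose A.transpose X.transpose where
  mul_mul := by
    rw [← Matrix.transpose_mul, ← Matrix.transpose_mul, ← mul_assoc, h.mul_mul]
  mul_mul' := by
    rw [← Matrix.transpose_mul, ← Matrix.transpose_mul, ← mul_assoc, h.mul_mul']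
  symm_left := by
    rw [← Matrix.transpose_mul, h.symm_right, h.symm_right]
  symm_right := by
    rw [← Matrix.transpose_mul, h.symm_left, h.symm_left]

theorem exists_isMoorePenrose_of_isHermitian (A : Matrix (Fin m) (Fin m) ℝ)
    (hA : A.IsHermitian) : ∃ X, IsMoorePenrose A X := by
  obtain ⟨U, d, hU, hAU⟩ : ∃ (U : Matrix (Fin m) (Fin m) ℝ) (d : Fin m → ℝ),
      U.transpose * U = 1 ∧ A = U * Matrix.diagonal d * U.transpose := by
    refine ⟨hA.eigenvectorUnitary, hA.eigenvalues, ?_, ?_⟩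
    · have h := Unitary.coe_star_mul_self hA.eigenvectorUnitary
      rw [Matrix.star_eq_conjTranspose, Matrix.conjTranspose_eq_transpose_of_trivial] at h
      exact h
    · have h := hA.spectral_theorem
      rw [Unitary.conjStarAlgAut_apply, Matrix.star_eq_conjTranspose,
        Matrix.conjTranspose_eq_transpose_of_trivial] at h
      exact h
  have key : ∀ a b : Fin m → ℝ,
      U * Matrix.diagonal a * U.transpose * (U * Matrix.diagonal b * U.transpose) =
        U * Matrix.diagonal (fun i => a i * b i) * U.transpose := by
    intro a b
    have : U * Matrix.diagonal a * U.transpose * (U * Matrix.diagonal b * U.transpose) =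
        U * Matrix.diagonal a * (U.transpose * U) * Matrix.diagonal b * U.transpose := by
      simp only [mul_assoc]
    rw [this, hU, mul_one, mul_assoc U, Matrix.diagonal_mul_diagonal]
  have ht : ∀ a : Fin m → ℝ, (U * Matrix.diagonal a * U.transpose).transpose =
      U * Matrix.diagonal a * U.transpose := by
    intro a
    simp [Matrix.transpose_mul, mul_assoc]
  refine ⟨U * Matrix.diagonal (fun i => (d i)⁻¹) * U.transpose, ?_, ?_, ?_, ?_⟩
  · rw [hAU, key, key]
    simp
  · have hd : (fun i => (d i)⁻¹ * d i * (d i)⁻¹) = fun i => (d i)⁻¹ := by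
      funext i
      by_cases h : d i = 0 <;> simp [h]
    rw [hAU, key, key, hd]
  · rw [hAU, key, ht]
  · rw [hAU, key, ht]

theorem exists_isMoorePenrose (A : Matrix (Fin m) (Fin m) ℝ) : ∃ X, IsMoorePenrose A X := by
  have hH : (A.transpose * A).transpose = A.transpose * A := by
    rw [Matrix.transpose_mul, Matrix.transpose_transpose]
  obtain ⟨Y, hY⟩ := exists_isMoorePenrose_of_isHermitian (A.transpose * A)
    (by rw [Matrix.IsHermitian, Matrix.conjTranspose_eq_transpose_of_trivial, hH])
  have hYt : Y.transpose = Y := by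
    have h := hY.transpose
    rw [hH] at h
    exact h.unique hY
  have hz : A * (Y * (A.transpose * A)) = A := by
    have h0 : A.transpose * A * (1 - Y * (A.transpose * A)) = 0 := by
      rw [mul_sub, mul_one, ← mul_assoc (A.transpose * A), hY.mul_mul, sub_self]
    rw [← Matrix.conjTranspose_eq_transpose_of_trivial,
      Matrix.conjTranspose_mul_self_mul_eq_zero,
      Matrix.conjTranspose_eq_transpose_of_trivial, mul_sub, mul_one, sub_eq_zero] at h0
    exact h0.symm
  refine ⟨Y * A.transpose, ?_, ?_, ?_, ?_⟩
  · rw [mul_assoc, mul_assoc Y, hz]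
  · have h := congrArg (fun M => M * A.transpose) hY.mul_mul'
    simpa only [mul_assoc] using h
  · rw [Matrix.transpose_mul, Matrix.transpose_mul, Matrix.transpose_transpose, hYt, mul_assoc]
  · rw [mul_assoc, hY.symm_right]

/-- The Moore-Penrose pseudoinverse `A⁺`. -/
def pinv (A : Matrix (Fin m) (Fin m) ℝ) : Matrix (Fin m) (Fin m) ℝ :=
  (exists_isMoorePenrose A).choose

theorem pinv_isMoorePenrose (A : Matrix (Fin m) (Fin m) ℝ) : IsMoorePenrose A (pinv A) :=
  (exists_isMoorePenrose A).choose_spec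

/-- The functional `W ↦ -∑_j e_jᵀ Wᵀ S⁺ W e_j`. -/
def objective (S W : Matrix (Fin m) (Fin m) ℝ) : ℝ :=
  -∑ j : Fin m, (Pi.single j (1 : ℝ)) ⬝ᵥ
    ((W.transpose * pinv S * W).mulVec (Pi.single j (1 : ℝ)))

end PseudoInverse

end EIT

end

/-! Reciprocity reduces the theorem to linear algebra in the Hilbert space `L²(B)ⁿ`. Testing the
equation of `u⁽ʲ⁾` with `v⁽ᵏ⁾` and the equation of `v⁽ᵏ⁾` with `u⁽ʲ⁾` gives `W j k = ∫_B ∇u⁽ʲ⁾ ⬝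
F⁽ᵏ⁾` (`IsSourceSolution.voltage_difference`). The measurements are therefore the inner products of
the sources with the fixed vectors `g j = ∇u⁽ʲ⁾|_B`, whose Gram matrix is `-S_B`
(`summedSensitivity_eq`).

Consistent sources form the preimage of a closed convex set under a continuous linear map, so a
source tuple of least norm exists and is unique as soon as one consistent tuple exists
(`exists_unique_minimal_sources`). For a fixed attainable `W` the least-norm sources are `F k = ∑ j,
A j k • g j` with `A = -S_B⁺ W`, and their squared norms add up to the value of the functional at
`W` (`exists_minimal_sources`). Minimizing the functional over `W` is thus the second stage of
minimizing the norm over the sources, and uniqueness carries over.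

Every `W` with zero column sums must be attainable. The range of the symmetric Gram matrix is the
orthogonal complement of its kernel, so it is enough that the kernel contains only constant vectors.
A kernel vector `a` makes `∑ a k • ∇u⁽ᵏ⁾` vanish on `B`; by unique continuation it vanishes on `Ω`,
so all electrode currents of the combination vanish, and these are the differences of consecutive
coefficients (`eq_of_sum_smul_grad_eq_zero`).

The potentials exist by Lax-Milgram (`exists_weak_solution`), which needs the Poincaré and trace
inequalities on a Lipschitz domain. Both come from one relation between measures, `PoincareRel`. It
holds on balls, spreads through `Ω` by connectedness, reaches the volume near the boundary by
translation in the inward direction, and reaches the surface measure by integration over inward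
segments; compactness leaves finitely many local estimates. -/

noncomputable section

namespace EIT

/-! ### Poincaré inequalities as a relation between measures -/

section PoincareRelation

variable {n : ℕ}

/-- The Dirichlet energy of `φ` on `Ω`. -/
def sqEnergy (Ω : Set (Space n)) (φ : Space n → ℝ) : ENNReal :=
  ∫⁻ x in Ω, ‖gradient φ x‖ₑ ^ 2

/-- The mean square difference of the values of `φ` with respect to `μ` and `ν`. -/
def sqDiff (μ ν : Measure (Space n)) (φ : Space n → ℝ) : ENNReal :=
  ∫⁻ x, ∫⁻ y, ‖φ x - φ y‖ₑ ^ 2 ∂ν ∂μ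

/-- The mean square difference of smooth functions with respect to `μ` and `ν` is controlled by the
Dirichlet energy on `Ω`. -/
def PoincareRel (Ω : Set (Space n)) (μ ν : Measure (Space n)) : Prop :=
  ∃ C : NNReal, ∀ φ : Space n → ℝ, ContDiff ℝ ∞ φ → sqDiff μ ν φ ≤ C * sqEnergy Ω φ

theorem enorm_add_sq_le (a b : ℝ) : ‖a + b‖ₑ ^ 2 ≤ 2 * ‖a‖ₑ ^ 2 + 2 * ‖b‖ₑ ^ 2 := by
  have h : ∀ a : ℝ, ‖a‖ₑ ^ 2 = ENNReal.ofReal (a ^ 2) := fun a => by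
    rw [← ofReal_norm, ← ENNReal.ofReal_pow (norm_nonneg _), Real.norm_eq_abs, sq_abs]
  have h2 : (2 : ENNReal) = ENNReal.ofReal 2 := by simp
  rw [h, h, h, h2, ← ENNReal.ofReal_mul (by norm_num), ← ENNReal.ofReal_mul (by norm_num),
    ← ENNReal.ofReal_add (by positivity) (by positivity)]
  exact ENNReal.ofReal_le_ofReal (by nlinarith [sq_nonneg (a - b)])

theorem enorm_sub_sq_le (a b c : ℝ) :
    ‖a - c‖ₑ ^ 2 ≤ 2 * ‖a - b‖ₑ ^ 2 + 2 * ‖b - c‖ₑ ^ 2 := by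
  have := enorm_add_sq_le (a - b) (b - c)
  rwa [sub_add_sub_cancel] at this

theorem sq_lintegral_le {α : Type*} [MeasurableSpace α] (μ : Measure α) {f : α → ENNReal}
    (hf : AEMeasurable f μ) : (∫⁻ x, f x ∂μ) ^ 2 ≤ μ Set.univ * ∫⁻ x, f x ^ 2 ∂μ := by
  have h := ENNReal.lintegral_mul_le_Lp_mul_Lq μ Real.HolderConjugate.two_two
    (f := fun _ => 1) aemeasurable_const hf
  simp only [Pi.mul_apply, one_mul, ENNReal.one_rpow, lintegral_const] at h
  calc (∫⁻ x, f x ∂μ) ^ 2 ≤ (μ Set.univ ^ (1 / 2 : ℝ) * (∫⁻ x, f x ^ (2:ℝ) ∂μ) ^ (1 / 2 : ℝ)) ^ 2 :=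
        pow_le_pow_left' h 2
    _ = _ := by
        rw [mul_pow, ← ENNReal.rpow_natCast, ← ENNReal.rpow_natCast, ← ENNReal.rpow_mul,
          ← ENNReal.rpow_mul]
        norm_num

theorem continuous_gradient {φ : Space n → ℝ} (hφ : ContDiff ℝ ∞ φ) : Continuous (gradient φ) := by
  unfold gradient
  exact (LinearIsometryEquiv.continuous _).comp (hφ.continuous_fderiv (by simp))

theorem inner_gradient_eq_fderiv (φ : Space n → ℝ) (x h : Space n) :
    inner ℝ (gradient φ x) h = fderiv ℝ φ x h := by
  simp [gradient]

/-- Fundamental theorem of calculus along the segment, then Cauchy-Schwarz on `(0, s]`, whose length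
is the factor `s`. -/
theorem enorm_sub_sq_le_lintegral_Ioc {φ : Space n → ℝ} (hφ : ContDiff ℝ ∞ φ)
    (x h : Space n) {s : ℝ} (hs : 0 ≤ s) :
    ‖φ (x + s • h) - φ x‖ₑ ^ 2 ≤ ENNReal.ofReal s *
      (‖h‖ₑ ^ 2 * ∫⁻ t in Set.Ioc (0 : ℝ) s, ‖gradient φ (x + t • h)‖ₑ ^ 2) := by
  have hc : Continuous fun t : ℝ => gradient φ (x + t • h) :=
    (continuous_gradient hφ).comp (by fun_prop)
  have h1 : φ (x + s • h) - φ x = ∫ t in (0 : ℝ)..s, inner ℝ (gradient φ (x + t • h)) h := by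
    rw [intervalIntegral.integral_eq_sub_of_hasDerivAt (f := fun t : ℝ => φ (x + t • h))]
    · simp
    · intro t _
      rw [inner_gradient_eq_fderiv]
      have hd : HasFDerivAt φ (fderiv ℝ φ (x + t • h)) (x + t • h) :=
        (hφ.differentiable (by simp) _).hasFDerivAt
      have hl : HasDerivAt (fun t : ℝ => x + t • h) h t := by
        simpa using ((hasDerivAt_id t).smul_const h).const_add x
      exact hd.comp_hasDerivAt t hl
    · exact (hc.inner continuous_const).intervalIntegrable _ _
  rw [h1, intervalIntegral.integral_of_le hs]
  calc ‖∫ t in Set.Ioc (0 : ℝ) s, inner ℝ (gradient φ (x + t • h)) h‖ₑ ^ 2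
      ≤ (∫⁻ t in Set.Ioc (0 : ℝ) s, ‖h‖ₑ * ‖gradient φ (x + t • h)‖ₑ) ^ 2 := by
        refine pow_le_pow_left' ((enorm_integral_le_lintegral_enorm _).trans ?_) 2
        refine lintegral_mono fun t => ?_
        rw [mul_comm]
        rw [← ofReal_norm, ← ofReal_norm, ← ofReal_norm, ← ENNReal.ofReal_mul (norm_nonneg _)]
        exact ENNReal.ofReal_le_ofReal (norm_inner_le_norm _ _)
    _ ≤ ENNReal.ofReal s *
          ∫⁻ t in Set.Ioc (0 : ℝ) s, (‖h‖ₑ * ‖gradient φ (x + t • h)‖ₑ) ^ 2 := by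
        have := sq_lintegral_le (volume.restrict (Set.Ioc (0 : ℝ) s))
          (f := fun t => ‖h‖ₑ * ‖gradient φ (x + t • h)‖ₑ)
          (hc.measurable.enorm.const_mul _).aemeasurable
        simpa using this
    _ = _ := by
        simp_rw [mul_pow]
        rw [lintegral_const_mul _ (hc.measurable.enorm.pow_const 2)]

theorem enorm_sub_sq_le_lintegral_segment {φ : Space n → ℝ} (hφ : ContDiff ℝ ∞ φ)
    (x h : Space n) :
    ‖φ (x + h) - φ x‖ₑ ^ 2 ≤
      ‖h‖ₑ ^ 2 * ∫⁻ t in Set.Ioc (0 : ℝ) 1, ‖gradient φ (x + t • h)‖ₑ ^ 2 := by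
  simpa using enorm_sub_sq_le_lintegral_Ioc hφ x h zero_le_one

theorem PoincareRel.mono {Ω : Set (Space n)} {μ μ' ν ν' : Measure (Space n)}
    (h : PoincareRel Ω μ ν) (hμ : μ' ≤ μ) (hν : ν' ≤ ν) : PoincareRel Ω μ' ν' := by
  obtain ⟨C, hC⟩ := h
  refine ⟨C, fun φ hφ => le_trans ?_ (hC φ hφ)⟩
  exact lintegral_mono' hμ fun x => lintegral_mono' hν le_rfl

theorem PoincareRel.add {Ω : Set (Space n)} {μ μ' ν : Measure (Space n)}
    (h : PoincareRel Ω μ ν) (h' : PoincareRel Ω μ' ν) : PoincareRel Ω (μ + μ') ν := by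
  obtain ⟨C, hC⟩ := h
  obtain ⟨C', hC'⟩ := h'
  refine ⟨C + C', fun φ hφ => ?_⟩
  unfold sqDiff at *
  rw [lintegral_add_measure, ENNReal.coe_add, add_mul]
  exact add_le_add (hC φ hφ) (hC' φ hφ)

theorem measurable_enorm_sub_sq {φ : Space n → ℝ} (hφ : Continuous φ) :
    Measurable (Function.uncurry fun x y : Space n => ‖φ x - φ y‖ₑ ^ 2) := by
  have : Continuous (Function.uncurry fun x y : Space n => φ x - φ y) := by
    unfold Function.uncurry; fun_prop
  exact this.measurable.enorm.pow_const 2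

theorem measurable_enorm_const_sub_sq {φ : Space n → ℝ} (hφ : Continuous φ) (x : Space n) :
    Measurable fun y : Space n => ‖φ x - φ y‖ₑ ^ 2 :=
  (continuous_const.sub hφ).measurable.enorm.pow_const 2

theorem measurable_lintegral_enorm_sub_sq {φ : Space n → ℝ} (hφ : Continuous φ)
    (ν : Measure (Space n)) [SFinite ν] :
    Measurable fun x : Space n => ∫⁻ y, ‖φ x - φ y‖ₑ ^ 2 ∂ν :=
  (measurable_enorm_sub_sq hφ).lintegral_prod_right

/-- Average `|φ x - φ z|² ≤ 2 |φ x - φ y|² + 2 |φ y - φ z|²` over the intermediate variable `y`. The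
left side gains the factor `ν Set.univ`, which can be divided out because `ν` is finite and nonzero.
-/
theorem PoincareRel.trans {Ω : Set (Space n)} {μ ν ρ : Measure (Space n)}
    [IsFiniteMeasure μ] [IsFiniteMeasure ν] [IsFiniteMeasure ρ] (hν : ν ≠ 0)
    (h : PoincareRel Ω μ ν) (h' : PoincareRel Ω ν ρ) : PoincareRel Ω μ ρ := by
  obtain ⟨C, hC⟩ := h
  obtain ⟨C', hC'⟩ := h'
  have hν0 : ν Set.univ ≠ 0 := by simpa using hν
  set a : NNReal := (ν Set.univ).toNNReal with ha
  have haν : (a : ENNReal) = ν Set.univ := ENNReal.coe_toNNReal (measure_ne_top _ _)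
  have ha0 : a ≠ 0 := by
    intro h0; rw [h0] at haν; exact hν0 (by simpa using haν.symm)
  set b : NNReal := (ρ Set.univ).toNNReal with hb
  have hbρ : (b : ENNReal) = ρ Set.univ := ENNReal.coe_toNNReal (measure_ne_top _ _)
  set d : NNReal := (μ Set.univ).toNNReal with hd
  have hdμ : (d : ENNReal) = μ Set.univ := ENNReal.coe_toNNReal (measure_ne_top _ _)
  refine ⟨a⁻¹ * (2 * b * C + 2 * d * C'), fun φ hφ => ?_⟩
  have key : (a : ENNReal) * sqDiff μ ρ φ ≤ (2 * b * C + 2 * d * C' : NNReal) * sqEnergy Ω φ := by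
    have hpt : ∀ x, (a : ENNReal) * ∫⁻ z, ‖φ x - φ z‖ₑ ^ 2 ∂ρ ≤
        2 * b * (∫⁻ y, ‖φ x - φ y‖ₑ ^ 2 ∂ν) + 2 * sqDiff ν ρ φ := by
      intro x
      have hmx : Measurable fun y => ‖φ x - φ y‖ₑ ^ 2 :=
        measurable_enorm_const_sub_sq hφ.continuous x
      calc (a : ENNReal) * ∫⁻ z, ‖φ x - φ z‖ₑ ^ 2 ∂ρ
          = ∫⁻ y, ∫⁻ z, ‖φ x - φ z‖ₑ ^ 2 ∂ρ ∂ν := by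
            rw [lintegral_const, haν, mul_comm]
        _ ≤ ∫⁻ y, (2 * b * ‖φ x - φ y‖ₑ ^ 2 + 2 * ∫⁻ z, ‖φ y - φ z‖ₑ ^ 2 ∂ρ) ∂ν := by
            refine lintegral_mono fun y => ?_
            have hmy : Measurable fun z => ‖φ y - φ z‖ₑ ^ 2 :=
              measurable_enorm_const_sub_sq hφ.continuous y
            calc ∫⁻ z, ‖φ x - φ z‖ₑ ^ 2 ∂ρ
                ≤ ∫⁻ z, (2 * ‖φ x - φ y‖ₑ ^ 2 + 2 * ‖φ y - φ z‖ₑ ^ 2) ∂ρ :=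
                  lintegral_mono fun z => enorm_sub_sq_le _ _ _
              _ = _ := by
                  rw [lintegral_add_left measurable_const, lintegral_const,
                    lintegral_const_mul _ hmy, hbρ]
                  ring
        _ = _ := by
            rw [lintegral_add_left (hmx.const_mul _), lintegral_const_mul _ hmx,
              lintegral_const_mul _ (measurable_lintegral_enorm_sub_sq hφ.continuous ρ)]
            rfl
    have hm1 : Measurable fun x => ∫⁻ z, ‖φ x - φ z‖ₑ ^ 2 ∂ρ :=
    measurable_lintegral_enorm_sub_sq hφ.continuous ρ
    have hm2 : Measurable fun x => ∫⁻ z, ‖φ x - φ z‖ₑ ^ 2 ∂ν :=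
    measurable_lintegral_enorm_sub_sq hφ.continuous ν
    calc (a : ENNReal) * sqDiff μ ρ φ
        = ∫⁻ x, a * ∫⁻ z, ‖φ x - φ z‖ₑ ^ 2 ∂ρ ∂μ := by
          rw [lintegral_const_mul _ hm1]; rfl
      _ ≤ ∫⁻ x, (2 * b * (∫⁻ y, ‖φ x - φ y‖ₑ ^ 2 ∂ν) + 2 * sqDiff ν ρ φ) ∂μ :=
          lintegral_mono hpt
      _ = 2 * b * sqDiff μ ν φ + 2 * d * sqDiff ν ρ φ := by
          rw [lintegral_add_right _ measurable_const, lintegral_const_mul _ hm2, lintegral_const,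
            hdμ]
          unfold sqDiff
          ring
      _ ≤ 2 * b * (C * sqEnergy Ω φ) + 2 * d * (C' * sqEnergy Ω φ) := by
          gcongr
          · exact hC φ hφ
          · exact hC' φ hφ
      _ = _ := by push_cast; ring
  calc sqDiff μ ρ φ = (a⁻¹ : NNReal) * ((a : ENNReal) * sqDiff μ ρ φ) := by
        rw [← mul_assoc, ← ENNReal.coe_mul, inv_mul_cancel₀ ha0]; simp
    _ ≤ (a⁻¹ : NNReal) * ((2 * b * C + 2 * d * C' : NNReal) * sqEnergy Ω φ) := by gcongr
    _ = _ := by rw [← mul_assoc, ← ENNReal.coe_mul]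

/-- Integrate the segment bound over `A` and exchange the integrals: for each `t` the translate of
`A` by `t • h` lies in `Ω`, and Lebesgue measure is translation invariant. -/
theorem lintegral_enorm_translate_sub_sq_le {Ω A : Set (Space n)} (hA : MeasurableSet A)
    (hΩ : MeasurableSet Ω) {h : Space n} (hAΩ : ∀ x ∈ A, ∀ t ∈ Set.Ioc (0 : ℝ) 1, x + t • h ∈ Ω)
    {φ : Space n → ℝ} (hφ : ContDiff ℝ ∞ φ) :
    ∫⁻ x in A, ‖φ (x + h) - φ x‖ₑ ^ 2 ≤ ‖h‖ₑ ^ 2 * sqEnergy Ω φ := by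
  have hg := continuous_gradient hφ
  have hcont : Continuous (Function.uncurry fun (x : Space n) (t : ℝ) =>
      gradient φ (x + t • h)) := by
    unfold Function.uncurry; fun_prop
  have hm : Measurable (Function.uncurry fun (x : Space n) (t : ℝ) =>
      ‖gradient φ (x + t • h)‖ₑ ^ 2) := hcont.measurable.enorm.pow_const 2
  calc ∫⁻ x in A, ‖φ (x + h) - φ x‖ₑ ^ 2
      ≤ ∫⁻ x in A, ‖h‖ₑ ^ 2 * ∫⁻ t in Set.Ioc (0 : ℝ) 1, ‖gradient φ (x + t • h)‖ₑ ^ 2 :=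
        lintegral_mono fun x => enorm_sub_sq_le_lintegral_segment hφ x h
    _ = ‖h‖ₑ ^ 2 * ∫⁻ x in A, ∫⁻ t in Set.Ioc (0 : ℝ) 1, ‖gradient φ (x + t • h)‖ₑ ^ 2 :=
        lintegral_const_mul _ hm.lintegral_prod_right
    _ = ‖h‖ₑ ^ 2 * ∫⁻ t in Set.Ioc (0 : ℝ) 1, ∫⁻ x in A, ‖gradient φ (x + t • h)‖ₑ ^ 2 := by
        rw [lintegral_lintegral_swap hm.aemeasurable]
    _ ≤ ‖h‖ₑ ^ 2 * ∫⁻ t in Set.Ioc (0 : ℝ) 1, sqEnergy Ω φ := by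
        refine mul_le_mul' le_rfl ?_
        refine setLIntegral_mono' measurableSet_Ioc fun t ht => ?_
        have hgm : Measurable fun x => ‖gradient φ x‖ₑ ^ 2 := hg.measurable.enorm.pow_const 2
        calc ∫⁻ x in A, ‖gradient φ (x + t • h)‖ₑ ^ 2
            = ∫⁻ x, A.indicator (fun x => ‖gradient φ (x + t • h)‖ₑ ^ 2) x :=
              (lintegral_indicator hA _).symm
          _ ≤ ∫⁻ x, Ω.indicator (fun x => ‖gradient φ x‖ₑ ^ 2) (x + t • h) := by
              refine lintegral_mono fun x => ?_
              by_cases hx : x ∈ A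
              · rw [Set.indicator_of_mem hx, Set.indicator_of_mem (hAΩ x hx t ht)]
              · rw [Set.indicator_of_notMem hx]; exact zero_le
          _ = ∫⁻ x, Ω.indicator (fun x => ‖gradient φ x‖ₑ ^ 2) x :=
              lintegral_add_right_eq_self (Ω.indicator fun x => ‖gradient φ x‖ₑ ^ 2) (t • h)
          _ = sqEnergy Ω φ := lintegral_indicator hΩ _
    _ = ‖h‖ₑ ^ 2 * sqEnergy Ω φ := by simp

/-- The substitution `z = y + h` leaves a translation estimate for each `h`. Convexity keeps the
segment from `y` to `y + h` inside the ball, and only `‖h‖ < 2 * r` contributes, hence the constant.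
-/
theorem PoincareRel.ball {Ω : Set (Space n)} (hΩ : MeasurableSet Ω) {x : Space n} {r : ℝ}
    (hr : Metric.ball x r ⊆ Ω) :
    PoincareRel Ω (volume.restrict (Metric.ball x r)) (volume.restrict (Metric.ball x r)) := by
  set U := Metric.ball x r with hU
  have hUm : MeasurableSet U := measurableSet_ball
  set D := Metric.ball (0 : Space n) (2 * r) with hD
  have hDm : MeasurableSet D := measurableSet_ball
  have hDv : volume D ≠ ⊤ := measure_ball_lt_top.ne
  refine ⟨(volume D).toNNReal * (2 * r).toNNReal ^ 2, fun φ hφ => ?_⟩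
  let f : Space n → Space n → ENNReal := fun y h =>
    U.indicator (fun y => U.indicator (fun z => ‖φ y - φ z‖ₑ ^ 2) (y + h)) y
  have hcm : Continuous fun p : Space n × Space n => φ p.1 - φ (p.1 + p.2) := by
    have := hφ.continuous; fun_prop
  have hfm : Measurable (Function.uncurry f) := by
    have : Function.uncurry f = ({p : Space n × Space n | p.1 ∈ U ∧ p.1 + p.2 ∈ U}).indicator
        fun p => ‖φ p.1 - φ (p.1 + p.2)‖ₑ ^ 2 := by
      ext ⟨y, h⟩
      by_cases hy : y ∈ U <;> by_cases hz : y + h ∈ U <;> simp [f, hy, hz, Set.indicator]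
    rw [this]
    refine Measurable.indicator (hcm.measurable.enorm.pow_const 2) ?_
    exact (measurable_fst hUm).inter ((measurable_fst.add measurable_snd) hUm)
  calc sqDiff (volume.restrict U) (volume.restrict U) φ
      = ∫⁻ y, ∫⁻ h, f y h := by
        unfold sqDiff
        rw [← lintegral_indicator hUm]
        refine lintegral_congr fun y => ?_
        by_cases hy : y ∈ U
        · simp only [f, Set.indicator_of_mem hy]
          rw [← lintegral_indicator hUm]
          exact (lintegral_add_left_eq_self (U.indicator fun z => ‖φ y - φ z‖ₑ ^ 2) y).symm
        · simp [f, hy]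
    _ = ∫⁻ h, ∫⁻ y, f y h := lintegral_lintegral_swap hfm.aemeasurable
    _ ≤ ∫⁻ h, D.indicator (fun _ => ENNReal.ofReal (2 * r) ^ 2 * sqEnergy Ω φ) h := by
        refine lintegral_mono fun h => ?_
        by_cases hh : h ∈ D
        · rw [Set.indicator_of_mem hh]
          have hAm : MeasurableSet {y | y ∈ U ∧ y + h ∈ U} :=
            hUm.inter ((measurable_id.add_const h) hUm)
          have e1 : ∫⁻ y, f y h = ∫⁻ y in {y | y ∈ U ∧ y + h ∈ U}, ‖φ (y + h) - φ y‖ₑ ^ 2 := by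
            rw [← lintegral_indicator hAm]
            refine lintegral_congr fun y => ?_
            by_cases hy : y ∈ U <;> by_cases hz : y + h ∈ U <;>
              simp [f, hy, hz, Set.indicator, ← enorm_neg (φ y - φ (y + h))]
          rw [e1]
          refine (lintegral_enorm_translate_sub_sq_le hAm hΩ ?_ hφ).trans ?_
          · intro y hy t ht
            refine hr ?_
            have := (convex_ball x r).add_smul_sub_mem hy.1 hy.2 ⟨ht.1.le, ht.2⟩
            rwa [add_sub_cancel_left] at this
          · gcongr
            rw [← ofReal_norm]
            exact ENNReal.ofReal_le_ofReal (by simpa [hD] using (mem_ball_zero_iff.1 hh).le)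
        · have : ∀ y, f y h = 0 := by
            intro y
            by_cases hy : y ∈ U
            · have hz : y + h ∉ U := by
                intro hz
                refine hh (mem_ball_zero_iff.2 ?_)
                have h1 := dist_triangle_right (y + h) y x
                have h2 := Metric.mem_ball.1 hy
                have h3 := Metric.mem_ball.1 hz
                rw [dist_self_add_left] at h1
                linarith
              simp [f, hz, Set.indicator]
            · simp [f, hy]
          simp [this]
    _ = _ := by
        rw [lintegral_indicator hDm, setLIntegral_const]
        push_cast
        rw [ENNReal.coe_toNNReal hDv, ENNReal.ofReal]
        ring

end PoincareRelation

/-! ### Geometry of the Lipschitz boundary charts -/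

section Charts

variable {n : ℕ}

/-- On `U`, the set `Ω` is the strict epigraph in the direction of the unit vector `e` of the
`K`-Lipschitz function `γ`. -/
structure IsEpigraphOn (Ω U : Set (Space n)) (e : Space n) (K : NNReal) (γ : Space n → ℝ) :
    Prop where
  norm_eq_one : ‖e‖ = 1
  lipschitz : LipschitzWith K γ
  mem_iff : ∀ y ∈ U, y ∈ Ω ↔ γ (y - inner ℝ e y • e) < inner ℝ e y

theorem IsBoundedLipschitzDomain.exists_isEpigraphOn {Ω : Set (Space n)}
    (hΩ : IsBoundedLipschitzDomain Ω) {x : Space n} (hx : x ∈ frontier Ω) :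
    ∃ (e : Space n) (K : NNReal) (γ : Space n → ℝ), ∃ ρ > 0,
      IsEpigraphOn Ω (Metric.ball x ρ) e K γ := by
  obtain ⟨U, e, K, γ, hU, hxU, he, hγ, h⟩ := hΩ.lipschitz_boundary x hx
  obtain ⟨ρ, hρ, hρU⟩ := Metric.isOpen_iff.1 hU x hxU
  exact ⟨e, K, γ, ρ, hρ, he, hγ, fun y hy => h y (hρU hy)⟩

namespace IsEpigraphOn

variable {Ω U : Set (Space n)} {e : Space n} {K : NNReal} {γ : Space n → ℝ}

theorem inner_add_smul (h : IsEpigraphOn Ω U e K γ) (y : Space n) (s : ℝ) :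
    inner ℝ e (y + s • e) = inner ℝ e y + s := by
  rw [inner_add_right, inner_smul_right, real_inner_self_eq_norm_sq, h.norm_eq_one]; ring

theorem proj_add_smul (h : IsEpigraphOn Ω U e K γ) (y : Space n) (s : ℝ) :
    y + s • e - inner ℝ e (y + s • e) • e = y - inner ℝ e y • e := by
  rw [h.inner_add_smul, add_smul]; abel

theorem mono (h : IsEpigraphOn Ω U e K γ) {U' : Set (Space n)} (hU : U' ⊆ U) :
    IsEpigraphOn Ω U' e K γ :=
  ⟨h.norm_eq_one, h.lipschitz, fun y hy => h.mem_iff y (hU hy)⟩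

/-- Moving along `e` changes the height and fixes the orthogonal component, so on a line in
direction `e` membership in `Ω` is a comparison of heights. Every inward push rests on this. -/
theorem add_smul_mem_iff (h : IsEpigraphOn Ω U e K γ) {y : Space n} {s : ℝ}
    (hy : y + s • e ∈ U) :
    y + s • e ∈ Ω ↔ γ (y - inner ℝ e y • e) < inner ℝ e y + s := by
  rw [h.mem_iff _ hy, h.proj_add_smul, h.inner_add_smul]

theorem continuous_graph (h : IsEpigraphOn Ω U e K γ) :
    Continuous fun y : Space n => γ (y - inner ℝ e y • e) := by
  have := h.lipschitz.continuous
  fun_prop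

theorem eq_of_mem_frontier (h : IsEpigraphOn Ω U e K γ) (hΩ : IsOpen Ω) (hU : IsOpen U)
    {y : Space n} (hy : y ∈ frontier Ω) (hyU : y ∈ U) :
    γ (y - inner ℝ e y • e) = inner ℝ e y := by
  refine le_antisymm ?_ ?_
  -- Strictly below the graph there is a neighbourhood that misses `Ω`, so the point is not in the
  -- closure.
  · by_contra! hlt
    have hopen : IsOpen {z : Space n | inner ℝ e z < γ (z - inner ℝ e z • e)} :=
      isOpen_lt (by fun_prop) h.continuous_graph
    obtain ⟨z, ⟨hz1, hz2⟩, hz⟩ := mem_closure_iff.1 hy.1 _ (hopen.inter hU) ⟨hlt, hyU⟩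
    exact absurd ((h.mem_iff z hz2).1 hz) (not_lt.2 (le_of_lt hz1))
  · by_contra! hlt
    have : y ∈ Ω := (h.mem_iff y hyU).2 hlt
    rw [hΩ.frontier_eq] at hy
    exact hy.2 this

theorem mem_frontier_of_eq (h : IsEpigraphOn Ω U e K γ) (hΩ : IsOpen Ω) (hU : IsOpen U)
    {y : Space n} (hyU : y ∈ U) (hy : γ (y - inner ℝ e y • e) = inner ℝ e y) :
    y ∈ frontier Ω := by
  rw [hΩ.frontier_eq]
  refine ⟨?_, fun hyΩ => absurd ((h.mem_iff y hyU).1 hyΩ) (by rw [hy]; exact lt_irrefl _)⟩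
  -- Points slightly above a point of the graph lie in `Ω` and converge to it.
  have hc : Tendsto (fun s : ℝ => y + s • e) (𝓝[>] 0) (𝓝 y) := by
    have : Tendsto (fun s : ℝ => y + s • e) (𝓝 0) (𝓝 (y + (0 : ℝ) • e)) :=
      Continuous.tendsto (by fun_prop) 0
    rw [zero_smul, add_zero] at this
    exact this.mono_left nhdsWithin_le_nhds
  refine mem_closure_of_tendsto hc ?_
  filter_upwards [hc.eventually_mem (hU.mem_nhds hyU), self_mem_nhdsWithin] with s hs hs0
  rw [h.add_smul_mem_iff hs, hy]
  exact lt_add_of_pos_right _ hs0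

end IsEpigraphOn

end Charts

/-! ### The Poincaré inequality on a bounded Lipschitz domain -/

section VolumePoincare

variable {n : ℕ}

theorem restrict_ball_ne_zero (x : Space n) {r : ℝ} (hr : 0 < r) :
    (volume.restrict (Metric.ball x r) : Measure (Space n)) ≠ 0 := by
  rw [Ne, Measure.restrict_eq_zero]
  exact (Metric.measure_ball_pos volume x hr).ne'

theorem isFiniteMeasure_restrict_of_isBounded {s : Set (Space n)} (hs : Bornology.IsBounded s) :
    IsFiniteMeasure (volume.restrict s) :=
  ⟨by rw [Measure.restrict_apply_univ]; exact hs.measure_lt_top⟩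

instance (x : Space n) (r : ℝ) : IsFiniteMeasure (volume.restrict (Metric.ball x r)) :=
  isFiniteMeasure_restrict_of_isBounded Metric.isBounded_ball

/-- Connectedness argument: the centres of balls in `Ω` that are related to the reference ball form
an open set. It is also relatively closed, because overlapping balls share a small ball of positive
measure, through which `PoincareRel.trans` passes. -/
theorem PoincareRel.ball_of_isConnected {Ω : Set (Space n)} (hΩ : IsOpen Ω)
    (hc : IsPreconnected Ω) {x₀ : Space n} {r₀ : ℝ} (hr₀ : 0 < r₀)
    (h₀ : Metric.ball x₀ r₀ ⊆ Ω) {x : Space n} {r : ℝ} (hr : 0 < r) (hx : Metric.ball x r ⊆ Ω) :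
    PoincareRel Ω (volume.restrict (Metric.ball x r)) (volume.restrict (Metric.ball x₀ r₀)) := by
  have hΩm := hΩ.measurableSet
  set β : Measure (Space n) := volume.restrict (Metric.ball x₀ r₀) with hβ
  have step : ∀ {x y : Space n} {r s : ℝ}, 0 < r → 0 < s → Metric.ball x r ⊆ Ω → y ∈ Metric.ball x r →
      PoincareRel Ω (volume.restrict (Metric.ball y s)) β →
      PoincareRel Ω (volume.restrict (Metric.ball x r)) β := by
    intro x y r s hr hs hx hy hrel
    have hs' : 0 < min s (r - dist y x) := lt_min hs (sub_pos.2 hy)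
    have h1 : Metric.ball y (min s (r - dist y x)) ⊆ Metric.ball x r := by
      refine Metric.ball_subset_ball' ?_
      have := min_le_right s (r - dist y x)
      linarith
    have h2 : Metric.ball y (min s (r - dist y x)) ⊆ Metric.ball y s :=
      Metric.ball_subset_ball (min_le_left _ _)
    exact PoincareRel.trans (restrict_ball_ne_zero y hs')
      ((PoincareRel.ball hΩm hx).mono le_rfl (Measure.restrict_mono h1 le_rfl))
      (hrel.mono (Measure.restrict_mono h2 le_rfl) le_rfl)
  let u : Set (Space n) := {x | ∃ r > 0, Metric.ball x r ⊆ Ω ∧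
    PoincareRel Ω (volume.restrict (Metric.ball x r)) β}
  have hu : IsOpen u := by
    rw [Metric.isOpen_iff]
    rintro x ⟨r, hr, hx, hrel⟩
    refine ⟨r, hr, fun y hy => ?_⟩
    have h1 : Metric.ball y (r - dist y x) ⊆ Metric.ball x r :=
      Metric.ball_subset_ball' (by linarith)
    exact ⟨r - dist y x, sub_pos.2 hy, h1.trans hx,
      hrel.mono (Measure.restrict_mono h1 le_rfl) le_rfl⟩
  have hsub : Ω ⊆ u := by
    refine hc.subset_of_closure_inter_subset hu ?_ ?_
    · exact ⟨x₀, h₀ (Metric.mem_ball_self hr₀), r₀, hr₀, h₀, PoincareRel.ball hΩm h₀⟩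
    · rintro x ⟨hxu, hxΩ⟩
      obtain ⟨r, hr, hx⟩ := Metric.isOpen_iff.1 hΩ x hxΩ
      obtain ⟨y, ⟨s, hs, _, hrel⟩, hyx⟩ := Metric.mem_closure_iff.1 hxu r hr
      exact ⟨r, hr, hx, step hr hs hx (by rwa [Metric.mem_ball, dist_comm]) hrel⟩
  obtain ⟨s, hs, _, hrel⟩ := hsub (hx (Metric.mem_ball_self hr))
  exact step hr hs hx (Metric.mem_ball_self hr) hrel

/-- The values on `A` are compared with those on its translate by the translation estimate, and the
translate with `ν` by hypothesis. This carries the relation from an interior ball to a part of `Ω`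
that touches the boundary. -/
theorem PoincareRel.of_shift {Ω A : Set (Space n)} (hΩ : MeasurableSet Ω) (hA : MeasurableSet A)
    {ν : Measure (Space n)} [IsFiniteMeasure ν] {U : Set (Space n)} (hU : MeasurableSet U)
    {h : Space n} (hAΩ : ∀ x ∈ A, ∀ t ∈ Set.Ioc (0 : ℝ) 1, x + t • h ∈ Ω)
    (hAU : ∀ x ∈ A, x + h ∈ U) (hrel : PoincareRel Ω (volume.restrict U) ν) :
    PoincareRel Ω (volume.restrict A) ν := by
  obtain ⟨C, hC⟩ := hrel
  set b : NNReal := (ν Set.univ).toNNReal with hb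
  have hbν : (b : ENNReal) = ν Set.univ := ENNReal.coe_toNNReal (measure_ne_top _ _)
  refine ⟨2 * ‖h‖₊ ^ 2 * b + 2 * C, fun φ hφ => ?_⟩
  set f : Space n → ENNReal := fun x => ∫⁻ z, ‖φ x - φ z‖ₑ ^ 2 ∂ν with hf
  have hfm : Measurable f := measurable_lintegral_enorm_sub_sq hφ.continuous ν
  have hm1 : Measurable fun x => ‖φ (x + h) - φ x‖ₑ ^ 2 := by
    have : Continuous fun x => φ (x + h) - φ x := by
      have := hφ.continuous; fun_prop
    exact this.measurable.enorm.pow_const 2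
  have hm2 : Measurable fun x => f (x + h) := hfm.comp (measurable_add_const h)
  have hpt : ∀ x, f x ≤ 2 * b * ‖φ (x + h) - φ x‖ₑ ^ 2 + 2 * f (x + h) := by
    intro x
    calc f x ≤ ∫⁻ z, (2 * ‖φ x - φ (x + h)‖ₑ ^ 2 + 2 * ‖φ (x + h) - φ z‖ₑ ^ 2) ∂ν :=
          lintegral_mono fun z => enorm_sub_sq_le _ _ _
      _ = _ := by
          rw [lintegral_add_left measurable_const, lintegral_const,
            lintegral_const_mul _ (measurable_enorm_const_sub_sq hφ.continuous _), ← hbν,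
            ← enorm_neg, neg_sub]
          ring
  calc sqDiff (volume.restrict A) ν φ = ∫⁻ x in A, f x := rfl
    _ ≤ ∫⁻ x in A, (2 * b * ‖φ (x + h) - φ x‖ₑ ^ 2 + 2 * f (x + h)) := lintegral_mono hpt
    _ = 2 * b * (∫⁻ x in A, ‖φ (x + h) - φ x‖ₑ ^ 2) + 2 * ∫⁻ x in A, f (x + h) := by
        rw [lintegral_add_left (hm1.const_mul _), lintegral_const_mul _ hm1,
          lintegral_const_mul _ hm2]
    _ ≤ 2 * b * (‖h‖ₑ ^ 2 * sqEnergy Ω φ) + 2 * (C * sqEnergy Ω φ) := by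
        refine add_le_add (mul_le_mul' le_rfl ?_) (mul_le_mul' le_rfl ?_)
        · exact lintegral_enorm_translate_sub_sq_le hA hΩ hAΩ hφ
        · refine le_trans ?_ (hC φ hφ)
          calc ∫⁻ x in A, f (x + h) = ∫⁻ x, A.indicator (fun x => f (x + h)) x :=
                (lintegral_indicator hA _).symm
            _ ≤ ∫⁻ x, U.indicator f (x + h) := by
                refine lintegral_mono fun x => ?_
                by_cases hx : x ∈ A
                · rw [Set.indicator_of_mem hx, Set.indicator_of_mem (hAU x hx)]
                · rw [Set.indicator_of_notMem hx]; exact zero_le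
            _ = ∫⁻ x, U.indicator f x := lintegral_add_right_eq_self (U.indicator f) h
            _ = sqDiff (volume.restrict U) ν φ := lintegral_indicator hU _
    _ = _ := by push_cast; rw [enorm_eq_nnnorm]; ring

/-- By compactness of `closure Ω` a local statement suffices. A point of `Ω` has a ball in `Ω`
around it; near a boundary point, the part of `Ω` is pushed along `e` into an interior ball. -/
theorem IsBoundedLipschitzDomain.poincareRel_volume {Ω : Set (Space n)}
    (hΩ : IsBoundedLipschitzDomain Ω) {x₀ : Space n} {r₀ : ℝ} (hr₀ : 0 < r₀)
    (h₀ : Metric.ball x₀ r₀ ⊆ Ω) :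
    PoincareRel Ω (volume.restrict Ω) (volume.restrict (Metric.ball x₀ r₀)) := by
  have hΩm := hΩ.isOpen.measurableSet
  set β : Measure (Space n) := volume.restrict (Metric.ball x₀ r₀) with hβ
  have hcomp : IsCompact (closure Ω) := hΩ.isBounded.isCompact_closure
  have : PoincareRel Ω (volume.restrict (Ω ∩ closure Ω)) β := by
    refine hcomp.induction_on (p := fun s => PoincareRel Ω (volume.restrict (Ω ∩ s)) β)
      ⟨0, fun φ _ => by simp [sqDiff]⟩ ?_ ?_ ?_
    · intro s t hst ht
      exact ht.mono (Measure.restrict_mono (Set.inter_subset_inter_right _ hst) le_rfl) le_rfl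
    · intro s t hs ht
      refine (hs.add ht).mono ?_ le_rfl
      rw [Set.inter_union_distrib_left]
      exact Measure.restrict_union_le _ _
    · intro x hx
      by_cases hxΩ : x ∈ Ω
      · obtain ⟨r, hr, hxr⟩ := Metric.isOpen_iff.1 hΩ.isOpen x hxΩ
        refine ⟨Metric.ball x r, mem_nhdsWithin_of_mem_nhds (Metric.ball_mem_nhds x hr), ?_⟩
        exact (PoincareRel.ball_of_isConnected hΩ.isOpen hΩ.isConnected.isPreconnected hr₀ h₀ hr
          hxr).mono (Measure.restrict_mono Set.inter_subset_right le_rfl) le_rfl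
      · have hxf : x ∈ frontier Ω := by rw [hΩ.isOpen.frontier_eq]; exact ⟨hx, hxΩ⟩
        obtain ⟨e, K, γ, ρ, hρ, hch⟩ := hΩ.exists_isEpigraphOn hxf
        have he := hch.norm_eq_one
        have hxe : x + (ρ / 2) • e ∈ Metric.ball x ρ := by
          rw [Metric.mem_ball, dist_self_add_left, norm_smul, he, Real.norm_of_nonneg (by linarith)]
          linarith
        have hxΩ' : x + (ρ / 2) • e ∈ Ω := by
          rw [hch.add_smul_mem_iff hxe,
            hch.eq_of_mem_frontier hΩ.isOpen Metric.isOpen_ball hxf (Metric.mem_ball_self hρ)]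
          linarith
        obtain ⟨r, hr, hxr⟩ := Metric.isOpen_iff.1 hΩ.isOpen _ hxΩ'
        -- The bound `r` makes the shifted piece land in the interior ball; the bound `ρ / 2` keeps
        -- the inward path of length `ρ / 2` inside the chart.
        have hδ : 0 < min r (ρ / 2) := lt_min hr (by linarith)
        refine ⟨Metric.ball x (min r (ρ / 2)),
          mem_nhdsWithin_of_mem_nhds (Metric.ball_mem_nhds x hδ), ?_⟩
        refine PoincareRel.of_shift hΩm (hΩm.inter measurableSet_ball)
          (U := Metric.ball (x + (ρ / 2) • e) r) measurableSet_ball (h := (ρ / 2) • e) ?_ ?_ ?_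
        · rintro y ⟨hy, hyb⟩ t ht
          have hyb' : dist y x < ρ / 2 := lt_of_lt_of_le hyb (min_le_right _ _)
          have ht' : 0 ≤ t * (ρ / 2) := by have := ht.1; positivity
          rw [smul_smul]
          have hyt : y + (t * (ρ / 2)) • e ∈ Metric.ball x ρ := by
            rw [Metric.mem_ball]
            calc dist (y + (t * (ρ / 2)) • e) x ≤ dist (y + (t * (ρ / 2)) • e) y + dist y x :=
                  dist_triangle _ _ _
              _ = t * (ρ / 2) + dist y x := by
                  rw [dist_self_add_left, norm_smul, he, Real.norm_of_nonneg ht', mul_one]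
              _ < ρ := by nlinarith [ht.2]
          rw [hch.add_smul_mem_iff hyt]
          have := (hch.mem_iff y (Metric.ball_subset_ball (by linarith) hyb')).1 hy
          linarith
        · rintro y ⟨hy, hyb⟩
          rw [Metric.mem_ball, dist_add_right]
          exact lt_of_lt_of_le hyb (min_le_left _ _)
        · exact PoincareRel.ball_of_isConnected hΩ.isOpen hΩ.isConnected.isPreconnected hr₀ h₀ hr
            hxr
  rwa [Set.inter_eq_self_of_subset_left subset_closure] at this

end VolumePoincare

/-! ### Graph coordinates and comparison of surface and Lebesgue measure -/

section GraphCoordinates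

variable {k : ℕ}

theorem exists_orthonormalBasis_zero_eq {e : Space (k + 1)} (he : ‖e‖ = 1) :
    ∃ b : OrthonormalBasis (Fin (k + 1)) ℝ (Space (k + 1)), b 0 = e := by
  obtain ⟨b, hb⟩ := Orthonormal.exists_orthonormalBasis_extension_of_card_eq (𝕜 := ℝ)
    (E := Space (k + 1)) (ι := Fin (k + 1)) (by simp) (v := fun _ => e) (s := {0})
    ⟨fun i => he, fun i j hij => absurd (Subsingleton.elim i j) hij⟩
  exact ⟨b, hb 0 rfl⟩

variable (b : OrthonormalBasis (Fin (k + 1)) ℝ (Space (k + 1)))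

/-- The parametrization of the hyperplane orthogonal to `b 0` by the remaining coordinates. -/
def hyperplaneMap : (Fin k → ℝ) →ₗ[ℝ] Space (k + 1) :=
  Fintype.linearCombination ℝ fun i : Fin k => b i.succ

/-- The coordinates of a point other than the one in the direction `b 0`. -/
def hyperplaneCoord (y : Space (k + 1)) : Fin k → ℝ := fun i => inner ℝ (b i.succ) y

theorem hyperplaneMap_apply (v : Fin k → ℝ) : hyperplaneMap b v = ∑ i, v i • b i.succ := by
  simp [hyperplaneMap, Fintype.linearCombination_apply]

theorem hyperplaneMap_coord (y : Space (k + 1)) :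
    hyperplaneMap b (hyperplaneCoord b y) = y - inner ℝ (b 0) y • b 0 := by
  have h := b.sum_repr' y
  rw [Fin.sum_univ_succ] at h
  rw [hyperplaneMap_apply, eq_sub_iff_add_eq]
  exact (add_comm _ _).trans h

theorem inner_hyperplaneMap (v : Fin k → ℝ) : inner ℝ (b 0) (hyperplaneMap b v) = 0 := by
  rw [hyperplaneMap_apply, inner_sum]
  refine Finset.sum_eq_zero fun i _ => ?_
  rw [inner_smul_right, b.inner_eq_zero (Fin.succ_ne_zero i).symm, mul_zero]

theorem hyperplaneCoord_map_add (v : Fin k → ℝ) (t : ℝ) :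
    hyperplaneCoord b (hyperplaneMap b v + t • b 0) = v := by
  ext i
  rw [hyperplaneCoord, inner_add_right, inner_smul_right, b.inner_eq_zero (Fin.succ_ne_zero i),
    hyperplaneMap_apply, inner_sum, mul_zero, add_zero]
  rw [Finset.sum_eq_single i]
  · simp [inner_smul_right]
  · intro j _ hj
    rw [inner_smul_right, b.inner_eq_zero (by simpa using hj.symm), mul_zero]
  · simp

theorem lipschitzWith_hyperplaneCoord : LipschitzWith 1 (hyperplaneCoord b) := by
  refine LipschitzWith.of_dist_le_mul fun x y => ?_
  rw [dist_pi_le_iff (by positivity)]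
  intro i
  rw [Real.dist_eq, hyperplaneCoord, hyperplaneCoord, ← inner_sub_right, NNReal.coe_one, one_mul,
    dist_eq_norm]
  have := abs_real_inner_le_norm (b i.succ) (x - y)
  rwa [b.norm_eq_one, one_mul] at this

theorem continuous_hyperplaneMap : Continuous (hyperplaneMap b) :=
  (hyperplaneMap b).continuous_of_finiteDimensional

/-- Orthonormal coordinates preserve volume, so Fubini separates height and hyperplane variables
without a Jacobian. -/
theorem measurePreserving_hyperplaneMap_add :
    MeasurePreserving (fun p : ℝ × (Fin k → ℝ) => hyperplaneMap b p.2 + p.1 • b 0) := by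
  have h := b.measurePreserving_repr_symm.comp
    ((PiLp.volume_preserving_toLp (Fin (k + 1))).comp
      (volume_preserving_piFinSuccAbove (fun _ : Fin (k + 1) => ℝ) 0).symm)
  have heq : (fun p : ℝ × (Fin k → ℝ) => hyperplaneMap b p.2 + p.1 • b 0) =
      b.repr.symm ∘ WithLp.toLp 2 ∘
        (MeasurableEquiv.piFinSuccAbove (fun _ : Fin (k + 1) => ℝ) 0).symm := by
    funext p
    change _ = b.repr.symm _
    rw [← OrthonormalBasis.sum_repr_symm, Fin.sum_univ_succ, hyperplaneMap_apply]
    refine (add_comm _ _).trans ?_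
    simp [MeasurableEquiv.piFinSuccAbove]
  rw [heq]
  exact h

/-- The parametrization of the graph of `γ` over the hyperplane orthogonal to `b 0`. -/
def graphMap (γ : Space (k + 1) → ℝ) (v : Fin k → ℝ) : Space (k + 1) :=
  hyperplaneMap b v + γ (hyperplaneMap b v) • b 0

theorem exists_lipschitzWith_graphMap {γ : Space (k + 1) → ℝ} {K : NNReal}
    (hγ : LipschitzWith K γ) : ∃ L : NNReal, LipschitzWith L (graphMap b γ) := by
  have h1 : LipschitzWith ‖(hyperplaneMap b).toContinuousLinearMap‖₊ (hyperplaneMap b) :=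
    (hyperplaneMap b).toContinuousLinearMap.lipschitz
  have h2 : LipschitzWith ‖(ContinuousLinearMap.toSpanSingleton ℝ (b 0))‖₊ fun t : ℝ => t • b 0 :=
    (ContinuousLinearMap.toSpanSingleton ℝ (b 0)).lipschitz
  exact ⟨_, h1.add (h2.comp (hγ.comp h1))⟩

theorem surfaceMeasure_eq (Ω : Set (Space (k + 1))) :
    surfaceMeasure Ω = (Measure.hausdorffMeasure (k : ℝ)).restrict (frontier Ω) := by
  simp [surfaceMeasure]

theorem hausdorffMeasure_fin_eq :
    (Measure.hausdorffMeasure (k : ℝ) : Measure (Fin k → ℝ)) = volume := by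
  have := hausdorffMeasure_pi_real (ι := Fin k)
  rwa [Fintype.card_fin] at this

variable {b}
variable {Ω U : Set (Space (k + 1))} {K : NNReal} {γ : Space (k + 1) → ℝ}

theorem IsEpigraphOn.graphMap_coord (h : IsEpigraphOn Ω U (b 0) K γ) (hΩ : IsOpen Ω)
    (hU : IsOpen U) {y : Space (k + 1)} (hy : y ∈ frontier Ω) (hyU : y ∈ U) :
    graphMap b γ (hyperplaneCoord b y) = y := by
  rw [graphMap, hyperplaneMap_coord, h.eq_of_mem_frontier hΩ hU hy hyU]
  abel

/-- The boundary inside the chart is the image of a parameter set under the Lipschitz map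
`graphMap`, which enlarges `k`-dimensional Hausdorff measure by at most `L ^ k`; on the parameter
space that measure is Lebesgue measure. This one-sided bound replaces the area formula. -/
theorem IsEpigraphOn.surfaceMeasure_le (h : IsEpigraphOn Ω U (b 0) K γ) (hΩ : IsOpen Ω)
    (hU : IsOpen U) {D : Set (Space (k + 1))} (hD : MeasurableSet D) (hDU : D ⊆ U) :
    ∃ C : NNReal, (surfaceMeasure Ω).restrict D ≤
      C • (volume.restrict (graphMap b γ ⁻¹' (D ∩ frontier Ω))).map (graphMap b γ) := by
  obtain ⟨L, hL⟩ := exists_lipschitzWith_graphMap b h.lipschitz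
  have hm : Measurable (graphMap b γ) := hL.continuous.measurable
  have hDm : MeasurableSet (D ∩ frontier Ω) := hD.inter isClosed_frontier.measurableSet
  refine ⟨L ^ k, Measure.le_iff.2 fun A hA => ?_⟩
  rw [surfaceMeasure_eq, Measure.restrict_restrict hD, Measure.restrict_apply hA,
    Measure.smul_apply, Measure.map_apply hm hA, Measure.restrict_apply (hm hA),
    ← Set.preimage_inter, ← hausdorffMeasure_fin_eq]
  have hsub : A ∩ (D ∩ frontier Ω) ⊆
      graphMap b γ '' (graphMap b γ ⁻¹' (A ∩ (D ∩ frontier Ω))) := by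
    intro y hy
    have := h.graphMap_coord hΩ hU hy.2.2 (hDU hy.2.1)
    exact ⟨hyperplaneCoord b y, by rwa [Set.mem_preimage, this], this⟩
  refine (measure_mono hsub).trans ((hL.hausdorffMeasure_image_le (by positivity) _).trans ?_)
  rw [ENNReal.rpow_natCast, ENNReal.smul_def, smul_eq_mul, ENNReal.coe_pow]

theorem IsEpigraphOn.surfaceMeasure_lt_top (h : IsEpigraphOn Ω U (b 0) K γ) (hΩ : IsOpen Ω)
    (hU : IsOpen U) {D : Set (Space (k + 1))} (hD : MeasurableSet D) (hDU : D ⊆ U)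
    (hb : Bornology.IsBounded D) : surfaceMeasure Ω D < ⊤ := by
  obtain ⟨C, hC⟩ := h.surfaceMeasure_le hΩ hU hD hDU
  have hm : Measurable (graphMap b γ) :=
    (exists_lipschitzWith_graphMap b h.lipschitz).choose_spec.continuous.measurable
  have h1 := hC Set.univ
  rw [Measure.restrict_apply_univ, Measure.smul_apply, Measure.map_apply hm MeasurableSet.univ,
    Set.preimage_univ, Measure.restrict_apply_univ, ENNReal.smul_def, smul_eq_mul] at h1
  refine h1.trans_lt (ENNReal.mul_lt_top ENNReal.coe_lt_top ?_)
  refine Bornology.IsBounded.measure_lt_top ?_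
  refine (((lipschitzWith_hyperplaneCoord b).isBounded_image hb)).subset fun v hv => ?_
  exact ⟨graphMap b γ v, hv.1, hyperplaneCoord_map_add b v _⟩

/-- Over distinct boundary points in `D` the inward segments lie on distinct lines parallel to `b
0`, and they lie in `Ω`. After passing to the parameter `v`, the iterated integral is bounded by
Fubini in the coordinates `(t, v)`. -/
theorem IsEpigraphOn.lintegral_surface_segment_le (h : IsEpigraphOn Ω U (b 0) K γ) (hΩ : IsOpen Ω)
    (hU : IsOpen U) {D : Set (Space (k + 1))} (hD : MeasurableSet D) (hDU : D ⊆ U) {r : ℝ}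
    (hDr : ∀ y ∈ D, ∀ s ∈ Set.Ioc 0 r, y + s • b 0 ∈ U) :
    ∃ C : NNReal, ∀ f : Space (k + 1) → ENNReal, Measurable f →
      ∫⁻ y in D, (∫⁻ s in Set.Ioc 0 r, f (y + s • b 0)) ∂(surfaceMeasure Ω) ≤
        C * ∫⁻ y in Ω, f y := by
  obtain ⟨C, hC⟩ := h.surfaceMeasure_le hΩ hU hD hDU
  have hg : Continuous (graphMap b γ) :=
    (exists_lipschitzWith_graphMap b h.lipschitz).choose_spec.continuous
  have hm : Measurable (graphMap b γ) := hg.measurable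
  have hγ : Continuous γ := h.lipschitz.continuous
  have hι := continuous_hyperplaneMap b
  refine ⟨C, fun f hf => ?_⟩
  have hF : Measurable fun y : Space (k + 1) => ∫⁻ s in Set.Ioc 0 r, f (y + s • b 0) := by
    have : Measurable (Function.uncurry fun (y : Space (k + 1)) (s : ℝ) => f (y + s • b 0)) :=
      hf.comp (by fun_prop)
    exact this.lintegral_prod_right
  have hpm := measurePreserving_hyperplaneMap_add b
  have hΩf : Measurable (Ω.indicator f) := hf.indicator hΩ.measurableSet
  calc ∫⁻ y in D, (∫⁻ s in Set.Ioc 0 r, f (y + s • b 0)) ∂(surfaceMeasure Ω)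
      ≤ ∫⁻ y, (∫⁻ s in Set.Ioc 0 r, f (y + s • b 0))
          ∂(C • (volume.restrict (graphMap b γ ⁻¹' (D ∩ frontier Ω))).map (graphMap b γ)) :=
        lintegral_mono' hC le_rfl
    _ = C * ∫⁻ v in graphMap b γ ⁻¹' (D ∩ frontier Ω),
          ∫⁻ s in Set.Ioc 0 r, f (graphMap b γ v + s • b 0) := by
        rw [lintegral_smul_measure, lintegral_map hF hm, ENNReal.smul_def, smul_eq_mul]
    _ ≤ C * ∫⁻ v, ∫⁻ t, Ω.indicator f (hyperplaneMap b v + t • b 0) := by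
        refine mul_le_mul' le_rfl ?_
        refine le_trans (setLIntegral_mono' (hm (hD.inter isClosed_frontier.measurableSet))
          fun v hv => ?_) (setLIntegral_le_lintegral _ _)
        have hv0 : graphMap b γ v ∈ U := hDU hv.1
        calc ∫⁻ s in Set.Ioc 0 r, f (graphMap b γ v + s • b 0)
            ≤ ∫⁻ s in Set.Ioc 0 r, Ω.indicator f (graphMap b γ v + s • b 0) := by
              refine setLIntegral_mono' measurableSet_Ioc fun s hs => ?_
              rw [Set.indicator_of_mem]
              rw [h.add_smul_mem_iff (hDr _ hv.1 s hs), h.eq_of_mem_frontier hΩ hU hv.2 hv0]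
              exact lt_add_of_pos_right _ hs.1
          _ ≤ ∫⁻ s, Ω.indicator f (graphMap b γ v + s • b 0) := setLIntegral_le_lintegral _ _
          _ = ∫⁻ t, Ω.indicator f (hyperplaneMap b v + t • b 0) := by
              rw [← lintegral_add_left_eq_self (fun t => Ω.indicator f (hyperplaneMap b v + t • b 0))
                (γ (hyperplaneMap b v))]
              simp only [graphMap, add_smul, add_assoc]
    _ = C * ∫⁻ y in Ω, f y := by
        congr 1
        have hm2 : Measurable (Function.uncurry fun (v : Fin k → ℝ) (t : ℝ) =>
            Ω.indicator f (hyperplaneMap b v + t • b 0)) :=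
          hΩf.comp (by fun_prop)
        rw [← lintegral_indicator hΩ.measurableSet, ← hpm.lintegral_comp hΩf, Measure.volume_eq_prod,
          lintegral_lintegral_swap hm2.aemeasurable]
        exact (lintegral_prod _ (hΩf.comp hpm.measurable).aemeasurable).symm

/-- The coordinate projection is 1-Lipschitz, so it does not increase Hausdorff measure, and the
image of the boundary piece contains a nonempty open set of parameters. -/
theorem IsEpigraphOn.surfaceMeasure_pos (h : IsEpigraphOn Ω U (b 0) K γ) (hΩ : IsOpen Ω)
    (hU : IsOpen U) {x : Space (k + 1)} (hx : x ∈ frontier Ω) (hxU : x ∈ U) :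
    0 < surfaceMeasure Ω U := by
  have hg : Continuous (graphMap b γ) :=
    (exists_lipschitzWith_graphMap b h.lipschitz).choose_spec.continuous
  have hopen : IsOpen (graphMap b γ ⁻¹' U) := hU.preimage hg
  have hne : (graphMap b γ ⁻¹' U).Nonempty :=
    ⟨hyperplaneCoord b x, by rwa [Set.mem_preimage, h.graphMap_coord hΩ hU hx hxU]⟩
  have hsub : graphMap b γ ⁻¹' U ⊆ hyperplaneCoord b '' (U ∩ frontier Ω) := by
    intro v hv
    refine ⟨graphMap b γ v, ⟨hv, h.mem_frontier_of_eq hΩ hU hv ?_⟩, hyperplaneCoord_map_add b v _⟩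
    rw [← hyperplaneMap_coord]
    rw [graphMap, hyperplaneCoord_map_add, inner_add_right, inner_smul_right, inner_hyperplaneMap,
      real_inner_self_eq_norm_sq, b.norm_eq_one]
    ring
  calc 0 < volume (graphMap b γ ⁻¹' U) := hopen.measure_pos volume hne
    _ ≤ volume (hyperplaneCoord b '' (U ∩ frontier Ω)) := measure_mono hsub
    _ ≤ (1 : NNReal) ^ (k : ℝ) * Measure.hausdorffMeasure (k : ℝ) (U ∩ frontier Ω) := by
        rw [← hausdorffMeasure_fin_eq]
        exact (lipschitzWith_hyperplaneCoord b).hausdorffMeasure_image_le (by positivity) _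
    _ = surfaceMeasure Ω U := by
        rw [surfaceMeasure_eq, Measure.restrict_apply hU.measurableSet]
        simp

end GraphCoordinates

/-! ### The trace inequality and finiteness of the surface measure -/

section SurfacePoincare

variable {k : ℕ} {b : OrthonormalBasis (Fin (k + 1)) ℝ (Space (k + 1))}
variable {Ω U : Set (Space (k + 1))} {K : NNReal} {γ : Space (k + 1) → ℝ}

/-- A boundary value is compared with the values at `y + s • b 0` through the gradient on the
segment, and the comparison is averaged over `s`. The resulting segment integrals are volume
integrals by `lintegral_surface_segment_le`, where `hν` applies. -/
theorem IsEpigraphOn.poincareRel_surface (h : IsEpigraphOn Ω U (b 0) K γ) (hΩ : IsOpen Ω)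
    (hU : IsOpen U) {D : Set (Space (k + 1))} (hD : MeasurableSet D) (hDU : D ⊆ U) {r : ℝ}
    (hr : 0 < r) (hDr : ∀ y ∈ D, ∀ s ∈ Set.Ioc 0 r, y + s • b 0 ∈ U)
    {ν : Measure (Space (k + 1))} [IsFiniteMeasure ν]
    (hν : PoincareRel Ω (volume.restrict Ω) ν) :
    PoincareRel Ω ((surfaceMeasure Ω).restrict D) ν := by
  obtain ⟨C, hC⟩ := h.lintegral_surface_segment_le hΩ hU hD hDU hDr
  obtain ⟨C', hC'⟩ := hν
  set a : NNReal := (ν Set.univ).toNNReal with ha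
  have haν : (a : ENNReal) = ν Set.univ := ENNReal.coe_toNNReal (measure_ne_top _ _)
  set R : NNReal := r.toNNReal with hR
  have hR0 : R ≠ 0 := (Real.toNNReal_pos.2 hr).ne'
  have hRr : ENNReal.ofReal r = R := rfl
  -- `R⁻¹` undoes the integration over `s ∈ (0, r]`, which multiplies the left side by `r`.
  refine ⟨R⁻¹ * (2 * a * R ^ 2 * C + 2 * C * C'), fun φ hφ => ?_⟩
  set f : Space (k + 1) → ENNReal := fun x => ∫⁻ z, ‖φ x - φ z‖ₑ ^ 2 ∂ν with hf
  have hfm : Measurable f := measurable_lintegral_enorm_sub_sq hφ.continuous ν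
  set g : Space (k + 1) → ENNReal := fun x => ‖gradient φ x‖ₑ ^ 2 with hg
  have hgm : Measurable g := (continuous_gradient hφ).measurable.enorm.pow_const 2
  have hsm : ∀ {f : Space (k + 1) → ENNReal}, Measurable f →
      Measurable fun y : Space (k + 1) => ∫⁻ s in Set.Ioc 0 r, f (y + s • b 0) := by
    intro f hf
    have : Measurable (Function.uncurry fun (y : Space (k + 1)) (s : ℝ) => f (y + s • b 0)) :=
      hf.comp (by fun_prop)
    exact this.lintegral_prod_right
  have hpt : ∀ y, (R : ENNReal) * f y ≤ 2 * a * R ^ 2 * (∫⁻ s in Set.Ioc 0 r, g (y + s • b 0)) +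
      2 * ∫⁻ s in Set.Ioc 0 r, f (y + s • b 0) := by
    intro y
    have h1 : ∀ s ∈ Set.Ioc 0 r, f y ≤ 2 * a * R * (∫⁻ s in Set.Ioc 0 r, g (y + s • b 0)) +
        2 * f (y + s • b 0) := by
      intro s hs
      calc f y ≤ ∫⁻ z, (2 * ‖φ y - φ (y + s • b 0)‖ₑ ^ 2 +
            2 * ‖φ (y + s • b 0) - φ z‖ₑ ^ 2) ∂ν := lintegral_mono fun z => enorm_sub_sq_le _ _ _
        _ = 2 * a * ‖φ (y + s • b 0) - φ y‖ₑ ^ 2 + 2 * f (y + s • b 0) := by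
            rw [lintegral_add_left measurable_const, lintegral_const,
              lintegral_const_mul _ (measurable_enorm_const_sub_sq hφ.continuous _), ← haν,
              ← enorm_neg, neg_sub]
            ring
        _ ≤ _ := by
            refine add_le_add ?_ le_rfl
            rw [mul_assoc (2 * (a : ENNReal))]
            refine mul_le_mul' le_rfl ?_
            refine (enorm_sub_sq_le_lintegral_Ioc hφ y (b 0) hs.1.le).trans ?_
            have hb1 : ‖b 0‖ₑ = 1 := by rw [← ofReal_norm, b.norm_eq_one]; simp
            rw [hb1, one_pow, one_mul]
            exact mul_le_mul' (ENNReal.ofReal_le_ofReal hs.2)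
              (lintegral_mono_set (Set.Ioc_subset_Ioc_right hs.2))
    have hfs : Measurable fun s : ℝ => f (y + s • b 0) := hfm.comp (by fun_prop)
    calc (R : ENNReal) * f y = ∫⁻ s in Set.Ioc 0 r, f y := by
          rw [setLIntegral_const, Real.volume_Ioc, sub_zero, hRr, mul_comm]
      _ ≤ ∫⁻ s in Set.Ioc 0 r, (2 * a * R * (∫⁻ s in Set.Ioc 0 r, g (y + s • b 0)) +
            2 * f (y + s • b 0)) := setLIntegral_mono' measurableSet_Ioc h1
      _ = _ := by
          rw [lintegral_add_left measurable_const, setLIntegral_const, Real.volume_Ioc, sub_zero,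
            hRr, lintegral_const_mul _ hfs]
          ring
  have key : (R : ENNReal) * sqDiff ((surfaceMeasure Ω).restrict D) ν φ ≤
      (2 * a * R ^ 2 * C + 2 * C * C' : NNReal) * sqEnergy Ω φ := by
    calc (R : ENNReal) * sqDiff ((surfaceMeasure Ω).restrict D) ν φ
        = ∫⁻ y in D, R * f y ∂(surfaceMeasure Ω) := (lintegral_const_mul _ hfm).symm
      _ ≤ ∫⁻ y in D, (2 * a * R ^ 2 * (∫⁻ s in Set.Ioc 0 r, g (y + s • b 0)) +
            2 * ∫⁻ s in Set.Ioc 0 r, f (y + s • b 0)) ∂(surfaceMeasure Ω) := lintegral_mono hpt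
      _ = 2 * a * R ^ 2 * (∫⁻ y in D, (∫⁻ s in Set.Ioc 0 r, g (y + s • b 0)) ∂(surfaceMeasure Ω)) +
            2 * ∫⁻ y in D, (∫⁻ s in Set.Ioc 0 r, f (y + s • b 0)) ∂(surfaceMeasure Ω) := by
          rw [lintegral_add_left ((hsm hgm).const_mul _), lintegral_const_mul _ (hsm hgm),
            lintegral_const_mul _ (hsm hfm)]
      _ ≤ 2 * a * R ^ 2 * (C * sqEnergy Ω φ) + 2 * (C * (C' * sqEnergy Ω φ)) := by
          refine add_le_add (mul_le_mul' le_rfl (hC g hgm)) (mul_le_mul' le_rfl ?_)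
          exact (hC f hfm).trans (mul_le_mul' le_rfl (hC' φ hφ))
      _ = _ := by push_cast; ring
  calc sqDiff ((surfaceMeasure Ω).restrict D) ν φ
      = (R⁻¹ : NNReal) * ((R : ENNReal) * sqDiff ((surfaceMeasure Ω).restrict D) ν φ) := by
        rw [← mul_assoc, ← ENNReal.coe_mul, inv_mul_cancel₀ hR0]; simp
    _ ≤ (R⁻¹ : NNReal) * ((2 * a * R ^ 2 * C + 2 * C * C' : NNReal) * sqEnergy Ω φ) := by gcongr
    _ = _ := by rw [← mul_assoc, ← ENNReal.coe_mul]

/-- Compactness of the boundary reduces both claims to chart balls of half the radius, from which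
inward segments of length `ρ / 2` do not leave the chart. -/
theorem IsBoundedLipschitzDomain.surface (hΩ : IsBoundedLipschitzDomain Ω)
    {x₀ : Space (k + 1)} {r₀ : ℝ} (hr₀ : 0 < r₀) (h₀ : Metric.ball x₀ r₀ ⊆ Ω) :
    surfaceMeasure Ω Set.univ < ⊤ ∧
      PoincareRel Ω (surfaceMeasure Ω) (volume.restrict (Metric.ball x₀ r₀)) := by
  have hcomp : IsCompact (frontier Ω) :=
    hΩ.isBounded.isCompact_closure.of_isClosed_subset isClosed_frontier frontier_subset_closure
  have hvol := hΩ.poincareRel_volume hr₀ h₀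
  have : surfaceMeasure Ω (frontier Ω) < ⊤ ∧ PoincareRel Ω
      ((surfaceMeasure Ω).restrict (frontier Ω)) (volume.restrict (Metric.ball x₀ r₀)) := by
    refine hcomp.induction_on (p := fun s => surfaceMeasure Ω s < ⊤ ∧
      PoincareRel Ω ((surfaceMeasure Ω).restrict s) (volume.restrict (Metric.ball x₀ r₀)))
      ⟨by simp, 0, fun φ _ => by simp [sqDiff]⟩ ?_ ?_ ?_
    · rintro s t hst ⟨ht1, ht2⟩
      exact ⟨(measure_mono hst).trans_lt ht1,
        ht2.mono (Measure.restrict_mono hst le_rfl) le_rfl⟩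
    · rintro s t ⟨hs1, hs2⟩ ⟨ht1, ht2⟩
      exact ⟨(measure_union_le _ _).trans_lt (ENNReal.add_lt_top.2 ⟨hs1, ht1⟩),
        (hs2.add ht2).mono (Measure.restrict_union_le _ _) le_rfl⟩
    · intro x hx
      obtain ⟨e, K, γ, ρ, hρ, hch⟩ := hΩ.exists_isEpigraphOn hx
      obtain ⟨b, rfl⟩ := exists_orthonormalBasis_zero_eq hch.norm_eq_one
      have hDU : Metric.ball x (ρ / 2) ⊆ Metric.ball x ρ := Metric.ball_subset_ball (by linarith)
      refine ⟨Metric.ball x (ρ / 2),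
        mem_nhdsWithin_of_mem_nhds (Metric.ball_mem_nhds x (by linarith)), ?_, ?_⟩
      · exact hch.surfaceMeasure_lt_top hΩ.isOpen Metric.isOpen_ball measurableSet_ball hDU
          Metric.isBounded_ball
      · refine hch.poincareRel_surface hΩ.isOpen Metric.isOpen_ball measurableSet_ball hDU
          (half_pos hρ) ?_ hvol
        intro y hy s hs
        rw [Metric.mem_ball] at hy ⊢
        calc dist (y + s • b 0) x ≤ dist (y + s • b 0) y + dist y x := dist_triangle _ _ _
          _ = s + dist y x := by
              rw [dist_self_add_left, norm_smul, b.norm_eq_one, Real.norm_of_nonneg hs.1.le, mul_one]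
          _ < ρ := by linarith [hs.2]
  have h2 : (surfaceMeasure Ω).restrict (frontier Ω) = surfaceMeasure Ω := by
    rw [surfaceMeasure, Measure.restrict_restrict isClosed_frontier.measurableSet, Set.inter_self]
  rw [h2] at this
  refine ⟨?_, this.2⟩
  rw [← h2, Measure.restrict_apply_univ]
  exact this.1

theorem IsBoundedLipschitzDomain.surfaceMeasure_pos (hΩ : IsBoundedLipschitzDomain Ω)
    {O : Set (Space (k + 1))} (hO : IsOpen O) (hne : (O ∩ frontier Ω).Nonempty) :
    0 < surfaceMeasure Ω (O ∩ frontier Ω) := by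
  obtain ⟨x, hxO, hx⟩ := hne
  obtain ⟨e, K, γ, ρ, hρ, hch⟩ := hΩ.exists_isEpigraphOn hx
  obtain ⟨b, rfl⟩ := exists_orthonormalBasis_zero_eq hch.norm_eq_one
  have h1 : 0 < surfaceMeasure Ω (Metric.ball x ρ ∩ O) :=
    (hch.mono Set.inter_subset_left).surfaceMeasure_pos hΩ.isOpen (Metric.isOpen_ball.inter hO) hx
      ⟨Metric.mem_ball_self hρ, hxO⟩
  have h2 : surfaceMeasure Ω (O ∩ frontier Ω) = surfaceMeasure Ω O := by
    rw [surfaceMeasure, Measure.restrict_apply hO.measurableSet,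
      Measure.restrict_apply (hO.measurableSet.inter isClosed_frontier.measurableSet),
      Set.inter_assoc, Set.inter_self]
  rw [h2]
  exact h1.trans_le (measure_mono Set.inter_subset_right)

end SurfacePoincare

/-! ### `H¹` functions with traces as a closed subspace -/

section TraceSpace

variable {n : ℕ} {Ω : Set (Space n)}

theorem contDiff_gradient_add {φ ψ : Space n → ℝ} (hφ : ContDiff ℝ ∞ φ) (hψ : ContDiff ℝ ∞ ψ) :
    gradient (φ + ψ) = gradient φ + gradient ψ := by
  funext x
  simp only [gradient, Pi.add_apply]
  rw [fderiv_add (hφ.differentiable (by simp) _) (hψ.differentiable (by simp) _), map_add]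

theorem contDiff_gradient_smul {φ : Space n → ℝ} (hφ : ContDiff ℝ ∞ φ) (c : ℝ) :
    gradient (c • φ) = c • gradient φ := by
  funext x
  simp only [gradient, Pi.smul_apply]
  rw [fderiv_const_smul (hφ.differentiable (by simp) _), map_smul]

theorem gradient_const_eq_zero (c : ℝ) : gradient (fun _ : Space n => c) = 0 := by
  funext x
  simp [gradient]

theorem memLp_of_continuous {E : Type*} [NormedAddCommGroup E]
    [SecondCountableTopologyEither (Space n) E] {f : Space n → E} (hf : Continuous f)
    {s : Set (Space n)} (hs : Bornology.IsBounded s) {ν : Measure (Space n)} [IsFiniteMeasure ν]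
    (hν : ∀ᵐ x ∂ν, x ∈ s) (p : ENNReal) : MemLp f p ν := by
  obtain ⟨C, hC⟩ := hs.isCompact_closure.exists_bound_of_continuousOn hf.continuousOn
  refine MemLp.of_bound hf.aestronglyMeasurable C ?_
  filter_upwards [hν] with x hx using hC x (subset_closure hx)

theorem ae_surfaceMeasure_mem : ∀ᵐ x ∂(surfaceMeasure Ω), x ∈ frontier Ω :=
  ae_restrict_mem isClosed_frontier.measurableSet

theorem memLp_volume_of_continuous {E : Type*} [NormedAddCommGroup E]
    [SecondCountableTopologyEither (Space n) E] {f : Space n → E} (hf : Continuous f)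
    (hΩ : Bornology.IsBounded Ω) (hΩm : MeasurableSet Ω) (p : ENNReal) :
    MemLp f p (volume.restrict Ω) :=
  haveI := isFiniteMeasure_restrict_of_isBounded hΩ
  memLp_of_continuous hf hΩ (ae_restrict_mem hΩm) p

theorem memLp_surface_of_continuous {E : Type*} [NormedAddCommGroup E]
    [SecondCountableTopologyEither (Space n) E] {f : Space n → E} (hf : Continuous f)
    (hΩ : Bornology.IsBounded Ω) (hS : IsFiniteMeasure (surfaceMeasure Ω)) (p : ENNReal) :
    MemLp f p (surfaceMeasure Ω) :=
  memLp_of_continuous hf (hΩ.closure.subset frontier_subset_closure) ae_surfaceMeasure_mem p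

/-- The space `L²(Ω) × L²(∂Ω) × L²(Ω)ⁿ` of functions, boundary values and gradients. -/
abbrev TripleSpace (Ω : Set (Space n)) : Type :=
  Lp ℝ 2 (volume.restrict Ω) × Lp ℝ 2 (surfaceMeasure Ω) × Lp (Space n) 2 (volume.restrict Ω)

/-- The triples `(φ, φ|_∂Ω, ∇φ)` of smooth functions. -/
def smoothTriples (Ω : Set (Space n)) : Submodule ℝ (TripleSpace Ω) where
  carrier := {x | ∃ φ : Space n → ℝ, ContDiff ℝ ∞ φ ∧ x.1 =ᵐ[volume.restrict Ω] φ ∧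
    x.2.1 =ᵐ[surfaceMeasure Ω] φ ∧ x.2.2 =ᵐ[volume.restrict Ω] gradient φ}
  add_mem' := by
    rintro x y ⟨φ, hφ, h1, h2, h3⟩ ⟨ψ, hψ, k1, k2, k3⟩
    refine ⟨φ + ψ, hφ.add hψ, ?_, ?_, ?_⟩
    · exact (Lp.coeFn_add _ _).trans (h1.add k1)
    · exact (Lp.coeFn_add _ _).trans (h2.add k2)
    · rw [contDiff_gradient_add hφ hψ]
      exact (Lp.coeFn_add _ _).trans (h3.add k3)
  zero_mem' := by
    refine ⟨fun _ => 0, contDiff_const, Lp.coeFn_zero _ _ _, Lp.coeFn_zero _ _ _, ?_⟩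
    rw [gradient_const_eq_zero]
    exact Lp.coeFn_zero _ _ _
  smul_mem' := by
    rintro c x ⟨φ, hφ, h1, h2, h3⟩
    refine ⟨c • φ, hφ.const_smul c, ?_, ?_, ?_⟩
    · exact (Lp.coeFn_smul _ _).trans (h1.const_smul c)
    · exact (Lp.coeFn_smul _ _).trans (h2.const_smul c)
    · rw [contDiff_gradient_smul hφ]
      exact (Lp.coeFn_smul _ _).trans (h3.const_smul c)

/-- The triples consisting of an `H¹(Ω)`-function, its trace and its gradient. -/
def traceSpace (Ω : Set (Space n)) : Submodule ℝ (TripleSpace Ω) :=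
  (smoothTriples Ω).topologicalClosure

/-- Closure points are limits of sequences, and convergence in the product is convergence of the
three norms in `HasTrace`. Traces thus become membership in a closed, hence complete, subspace. -/
theorem mem_traceSpace_iff (hΩ : Bornology.IsBounded Ω) (hΩm : MeasurableSet Ω)
    (hS : IsFiniteMeasure (surfaceMeasure Ω)) {x : TripleSpace Ω} :
    x ∈ traceSpace Ω ↔ HasTrace Ω x.1 x.2.2 x.2.1 := by
  rw [traceSpace, ← SetLike.mem_coe, Submodule.topologicalClosure_coe, mem_closure_iff_seq_limit]
  constructor
  · rintro ⟨y, hy, hyx⟩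
    choose φ hφ h1 h2 h3 using hy
    rw [Prod.tendsto_iff, Prod.tendsto_iff] at hyx
    refine ⟨Lp.memLp _, φ, hφ, ?_, ?_, ?_⟩
    · refine ((Lp.tendsto_Lp_iff_tendsto_eLpNorm' _ _).1 hyx.1).congr fun i => ?_
      exact eLpNorm_congr_ae ((h1 i).sub (EventuallyEq.refl _ _))
    · refine ((Lp.tendsto_Lp_iff_tendsto_eLpNorm' _ _).1 hyx.2.2).congr fun i => ?_
      exact eLpNorm_congr_ae ((h3 i).sub (EventuallyEq.refl _ _))
    · refine ((Lp.tendsto_Lp_iff_tendsto_eLpNorm' _ _).1 hyx.2.1).congr fun i => ?_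
      exact eLpNorm_congr_ae ((h2 i).sub (EventuallyEq.refl _ _))
  · rintro ⟨_, φ, hφ, h1, h2, h3⟩
    have m1 : ∀ i, MemLp (φ i) 2 (volume.restrict Ω) := fun i =>
      memLp_volume_of_continuous (hφ i).continuous hΩ hΩm 2
    have m2 : ∀ i, MemLp (gradient (φ i)) 2 (volume.restrict Ω) := fun i =>
      memLp_volume_of_continuous (continuous_gradient (hφ i)) hΩ hΩm 2
    have m3 : ∀ i, MemLp (φ i) 2 (surfaceMeasure Ω) := fun i =>
      memLp_surface_of_continuous (hφ i).continuous hΩ hS 2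
    refine ⟨fun i => ((m1 i).toLp, (m3 i).toLp, (m2 i).toLp), fun i => ⟨φ i, hφ i,
      (m1 i).coeFn_toLp, (m3 i).coeFn_toLp, (m2 i).coeFn_toLp⟩, ?_⟩
    rw [Prod.tendsto_iff, Prod.tendsto_iff]
    refine ⟨?_, ?_, ?_⟩
    · refine (Lp.tendsto_Lp_iff_tendsto_eLpNorm' _ _).2 (h1.congr fun i => ?_)
      exact eLpNorm_congr_ae ((m1 i).coeFn_toLp.symm.sub (EventuallyEq.refl _ _))
    · refine (Lp.tendsto_Lp_iff_tendsto_eLpNorm' _ _).2 (h3.congr fun i => ?_)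
      exact eLpNorm_congr_ae ((m3 i).coeFn_toLp.symm.sub (EventuallyEq.refl _ _))
    · refine (Lp.tendsto_Lp_iff_tendsto_eLpNorm' _ _).2 (h2.congr fun i => ?_)
      exact eLpNorm_congr_ae ((m2 i).coeFn_toLp.symm.sub (EventuallyEq.refl _ _))

theorem HasTrace.congr {u u' : Space n → ℝ} {G G' : Space n → Space n} {g g' : Space n → ℝ}
    (h : HasTrace Ω u G g) (hu : u =ᵐ[volume.restrict Ω] u') (hG : G =ᵐ[volume.restrict Ω] G')
    (hg : g =ᵐ[surfaceMeasure Ω] g') : HasTrace Ω u' G' g' := by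
  obtain ⟨hm, φ, hφ, h1, h2, h3⟩ := h
  refine ⟨hm.ae_eq hg, φ, hφ, h1.congr fun i => ?_, h2.congr fun i => ?_, h3.congr fun i => ?_⟩
  · exact eLpNorm_congr_ae ((EventuallyEq.refl _ _).sub hu)
  · exact eLpNorm_congr_ae ((EventuallyEq.refl _ _).sub hG)
  · exact eLpNorm_congr_ae ((EventuallyEq.refl _ _).sub hg)

theorem HasTrace.toLp_mem (hΩ : Bornology.IsBounded Ω) (hΩm : MeasurableSet Ω)
    (hS : IsFiniteMeasure (surfaceMeasure Ω)) {u : Space n → ℝ} {G : Space n → Space n}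
    {g : Space n → ℝ} (hu : MemLp u 2 (volume.restrict Ω)) (hG : MemLp G 2 (volume.restrict Ω))
    (h : HasTrace Ω u G g) :
    ((hu.toLp, h.1.toLp, hG.toLp) : TripleSpace Ω) ∈ traceSpace Ω := by
  rw [mem_traceSpace_iff hΩ hΩm hS]
  exact h.congr hu.coeFn_toLp.symm hG.coeFn_toLp.symm h.1.coeFn_toLp.symm

theorem integral_mul_gradient_eq {φ ψ : Space n → ℝ} (hφ : ContDiff ℝ ∞ φ) (hψ : ContDiff ℝ ∞ ψ)
    (hc : HasCompactSupport ψ) (hψΩ : tsupport ψ ⊆ Ω) (v : Space n) :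
    ∫ x in Ω, φ x * inner ℝ (gradient ψ x) v = - ∫ x in Ω, ψ x * inner ℝ (gradient φ x) v := by
  have hφ' := hφ.continuous_fderiv (by simp)
  have hψ' := hψ.continuous_fderiv (by simp)
  have h0 : ∀ x, x ∉ tsupport ψ → ψ x = 0 := fun x hx => image_eq_zero_of_notMem_tsupport hx
  have h1 : ∀ x, x ∉ tsupport ψ → fderiv ℝ ψ x = 0 := fun x hx =>
    image_eq_zero_of_notMem_tsupport fun h => hx (tsupport_fderiv_subset ℝ (f := ψ) h)
  have e1 : ∫ x in Ω, φ x * inner ℝ (gradient ψ x) v = ∫ x, φ x * fderiv ℝ ψ x v := by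
    simp only [inner_gradient_eq_fderiv]
    refine setIntegral_eq_integral_of_forall_compl_eq_zero fun x hx => ?_
    rw [h1 x fun h => hx (hψΩ h)]; simp
  have e2 : ∫ x in Ω, ψ x * inner ℝ (gradient φ x) v = ∫ x, fderiv ℝ φ x v * ψ x := by
    simp only [inner_gradient_eq_fderiv]
    rw [setIntegral_eq_integral_of_forall_compl_eq_zero fun x hx => ?_]
    · simp only [mul_comm]
    · rw [h0 x fun h => hx (hψΩ h), zero_mul]
  rw [e1, e2]
  have hcomp : IsCompact (tsupport ψ) := hc
  refine integral_mul_fderiv_eq_neg_fderiv_mul_of_integrable ?_ ?_ ?_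
    (fun x _ => hφ.differentiable (by simp) x) (fun x _ => hψ.differentiable (by simp) x)
  · refine Continuous.integrable_of_hasCompactSupport
      ((hφ'.clm_apply continuous_const).mul hψ.continuous) ?_
    exact HasCompactSupport.intro hcomp fun x hx => by simp [h0 x hx]
  · refine Continuous.integrable_of_hasCompactSupport
      (hφ.continuous.mul (hψ'.clm_apply continuous_const)) ?_
    exact HasCompactSupport.intro hcomp fun x hx => by simp [h1 x hx]
  · refine Continuous.integrable_of_hasCompactSupport (hφ.continuous.mul hψ.continuous) ?_
    exact HasCompactSupport.intro hcomp fun x hx => by simp [h0 x hx]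

/-- For a fixed test function and direction, integration by parts says that a continuous functional
`L` on triples vanishes. It vanishes on smooth triples, hence on their closure. -/
theorem isH1_of_mem_traceSpace (hΩ : Bornology.IsBounded Ω) (hΩm : MeasurableSet Ω)
    {x : TripleSpace Ω} (hx : x ∈ traceSpace Ω) : IsH1 Ω x.1 x.2.2 := by
  refine ⟨Lp.memLp _, Lp.memLp _, fun ψ hψ hc hψΩ => ?_⟩
  have mψ : MemLp ψ 2 (volume.restrict Ω) := memLp_volume_of_continuous hψ.continuous hΩ hΩm 2
  have mψ' : MemLp (gradient ψ) 2 (volume.restrict Ω) :=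
    memLp_volume_of_continuous (continuous_gradient hψ) hΩ hΩm 2
  have hcomp : ∀ v : Space n, ∫ y in Ω, x.1 y * inner ℝ (gradient ψ y) v =
      - ∫ y in Ω, ψ y * inner ℝ (x.2.2 y) v := by
    intro v
    have m1 : MemLp (fun y => inner ℝ (gradient ψ y) v) 2 (volume.restrict Ω) := mψ'.inner_const v
    have m2 : MemLp (fun y => ψ y • v) 2 (volume.restrict Ω) :=
      memLp_volume_of_continuous (hψ.continuous.smul continuous_const) hΩ hΩm 2
    let L : TripleSpace Ω → ℝ := fun z => inner ℝ z.1 m1.toLp + inner ℝ z.2.2 m2.toLp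
    have hL : ∀ z, L z = (∫ y in Ω, z.1 y * inner ℝ (gradient ψ y) v) +
        ∫ y in Ω, ψ y * inner ℝ (z.2.2 y) v := by
      intro z
      simp only [L, L2.inner_def]
      congr 1
      · refine integral_congr_ae ?_
        filter_upwards [m1.coeFn_toLp] with y hy
        rw [hy]; simp [mul_comm]
      · refine integral_congr_ae ?_
        filter_upwards [m2.coeFn_toLp] with y hy
        rw [hy, inner_smul_right]
    have hLc : Continuous L := by fun_prop
    have hcl : IsClosed {z | L z = 0} := isClosed_eq hLc continuous_const
    have hsub : (smoothTriples Ω : Set (TripleSpace Ω)) ⊆ {z | L z = 0} := by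
      rintro z ⟨φ, hφ, h1, _, h3⟩
      have e1 : ∫ y in Ω, z.1 y * inner ℝ (gradient ψ y) v =
          ∫ y in Ω, φ y * inner ℝ (gradient ψ y) v := by
        refine integral_congr_ae ?_
        filter_upwards [h1] with y hy
        rw [hy]
      have e2 : ∫ y in Ω, ψ y * inner ℝ (z.2.2 y) v =
          ∫ y in Ω, ψ y * inner ℝ (gradient φ y) v := by
        refine integral_congr_ae ?_
        filter_upwards [h3] with y hy
        rw [hy]
      change L z = 0
      rw [hL, e1, e2, integral_mul_gradient_eq hφ hψ hc hψΩ]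
      ring
    have hx0 : L x = 0 := closure_minimal hsub hcl hx
    rw [hL] at hx0
    linarith
  have i1 : Integrable (fun y => x.1 y • gradient ψ y) (volume.restrict Ω) :=
    memLp_one_iff_integrable.1 (mψ'.smul (Lp.memLp x.1))
  have i2 : Integrable (fun y => ψ y • x.2.2 y) (volume.restrict Ω) :=
    memLp_one_iff_integrable.1 ((Lp.memLp x.2.2).smul mψ)
  refine ext_inner_left ℝ fun v => ?_
  rw [inner_neg_right, ← integral_inner i1, ← integral_inner i2]
  simp only [inner_smul_right]
  have := hcomp v
  simpa only [real_inner_comm] using this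

/-- The triple of a constant function. -/
theorem const_mem_traceSpace [IsFiniteMeasure (volume.restrict Ω)]
    [IsFiniteMeasure (surfaceMeasure Ω)] (a : ℝ) :
    ((Lp.const 2 _ a, Lp.const 2 _ a, 0) : TripleSpace Ω) ∈ traceSpace Ω := by
  refine Submodule.le_topologicalClosure _ ⟨fun _ => a, contDiff_const, Lp.coeFn_const _ _ _,
    Lp.coeFn_const _ _ _, ?_⟩
  rw [gradient_const_eq_zero]
  exact Lp.coeFn_zero _ _ _

end TraceSpace

/-! ### Mean values and the inequalities in norm form -/

section MeanValue

variable {n : ℕ}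

theorem sq_eLpNorm_two {α E : Type*} [MeasurableSpace α] [NormedAddCommGroup E] (ν : Measure α)
    (f : α → E) : eLpNorm f 2 ν ^ 2 = ∫⁻ x, ‖f x‖ₑ ^ 2 ∂ν := by
  have h := eLpNorm_nnreal_pow_eq_lintegral (μ := ν) (f := f) (p := 2) two_ne_zero
  simpa using h

/-- The mean value over `A` of an `L²`-function. -/
def meanL2 {α : Type*} [MeasurableSpace α] (ν : Measure α) {A : Set α} (hA : MeasurableSet A)
    (hν : ν A ≠ ⊤) : Lp ℝ 2 ν →L[ℝ] ℝ :=
  (ν.real A)⁻¹ • innerSL ℝ (indicatorConstLp 2 hA hν (1 : ℝ))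

theorem meanL2_apply {α : Type*} [MeasurableSpace α] (ν : Measure α) {A : Set α}
    (hA : MeasurableSet A) (hν : ν A ≠ ⊤) (f : Lp ℝ 2 ν) :
    meanL2 ν hA hν f = (ν.real A)⁻¹ * ∫ x in A, f x ∂ν := by
  rw [← L2.inner_indicatorConstLp_one (𝕜 := ℝ) hA hν]
  rfl

theorem meanL2_eq_of_ae_eq {α : Type*} [MeasurableSpace α] (ν : Measure α) {A : Set α}
    (hA : MeasurableSet A) (hν : ν A ≠ ⊤) (h0 : ν A ≠ 0) {f : Lp ℝ 2 ν} {c : ℝ}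
    (hf : ∀ᵐ x ∂(ν.restrict A), f x = c) : meanL2 ν hA hν f = c := by
  have h : ν.real A ≠ 0 := by
    rw [measureReal_def]; exact (ENNReal.toReal_pos h0 hν).ne'
  rw [meanL2_apply, integral_congr_ae hf, setIntegral_const, smul_eq_mul, ← mul_assoc,
    inv_mul_cancel₀ h, one_mul]

/-- The deviation from the mean is the mean of `φ x - φ y` over `y`; Cauchy-Schwarz bounds its
square by the mean of the squares, and integrating in `x` gives `sqDiff`. -/
theorem PoincareRel.eLpNorm_sub_mean_le {Ω A : Set (Space n)} {ν : Measure (Space n)}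
    (hb : Bornology.IsBounded A) (hA : MeasurableSet A) (h0 : volume A ≠ 0)
    (h : PoincareRel Ω ν (volume.restrict A)) :
    ∃ C : NNReal, ∀ φ : Space n → ℝ, ContDiff ℝ ∞ φ →
      eLpNorm (fun x => φ x - (volume.real A)⁻¹ * ∫ y in A, φ y) 2 ν ≤
        C * eLpNorm (gradient φ) 2 (volume.restrict Ω) := by
  obtain ⟨C, hC⟩ := h
  have htop : volume A ≠ ⊤ := hb.measure_lt_top.ne
  have := isFiniteMeasure_restrict_of_isBounded hb
  set v : NNReal := (volume A).toNNReal with hv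
  have hvA : (v : ENNReal) = volume A := ENNReal.coe_toNNReal htop
  have hv0 : v ≠ 0 := by
    intro h; rw [h] at hvA; exact h0 (by simpa using hvA.symm)
  have hvr : volume.real A = v := rfl
  -- The squared inequality holds with `t = v⁻¹ * C`; since `t ≤ (t + 1) ^ 2`, the value `t + 1`
  -- serves in place of the square root.
  refine ⟨v⁻¹ * C + 1, fun φ hφ => ?_⟩
  have hint : Integrable φ (volume.restrict A) :=
    (memLp_volume_of_continuous hφ.continuous hb hA 1).integrable le_rfl
  have hpt : ∀ x, ‖φ x - (volume.real A)⁻¹ * ∫ y in A, φ y‖ₑ ^ 2 ≤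
      (v⁻¹ : NNReal) * ∫⁻ y in A, ‖φ x - φ y‖ₑ ^ 2 := by
    intro x
    have e : φ x - (volume.real A)⁻¹ * ∫ y in A, φ y =
        (v⁻¹ : NNReal) * ∫ y in A, (φ x - φ y) := by
      have hv0' : (v : ℝ) ≠ 0 := by exact_mod_cast hv0
      rw [integral_sub (integrable_const _) hint, setIntegral_const, hvr, smul_eq_mul, mul_sub,
        NNReal.coe_inv, ← mul_assoc, inv_mul_cancel₀ hv0', one_mul]
    have hm : AEMeasurable (fun y => ‖φ x - φ y‖ₑ) (volume.restrict A) :=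
      (continuous_const.sub hφ.continuous).measurable.enorm.aemeasurable
    have e2 : ‖((v⁻¹ : NNReal) : ℝ)‖ₑ = (v⁻¹ : NNReal) := by
      rw [← ofReal_norm, Real.norm_of_nonneg (NNReal.coe_nonneg _), ENNReal.ofReal_coe_nnreal]
    have hle := sq_lintegral_le (volume.restrict A) hm
    rw [Measure.restrict_apply_univ, ← hvA] at hle
    calc ‖φ x - (volume.real A)⁻¹ * ∫ y in A, φ y‖ₑ ^ 2
        = ((v⁻¹ : NNReal) : ENNReal) ^ 2 * ‖∫ y in A, (φ x - φ y)‖ₑ ^ 2 := by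
          rw [e, enorm_mul, e2, mul_pow]
      _ ≤ ((v⁻¹ : NNReal) : ENNReal) ^ 2 * (∫⁻ y in A, ‖φ x - φ y‖ₑ) ^ 2 := by
          gcongr
          exact enorm_integral_le_lintegral_enorm _
      _ ≤ ((v⁻¹ : NNReal) : ENNReal) ^ 2 * (v * ∫⁻ y in A, ‖φ x - φ y‖ₑ ^ 2) := by
          gcongr
      _ = _ := by
          rw [← mul_assoc, ← ENNReal.coe_pow, ← ENNReal.coe_mul, pow_two, mul_assoc,
            inv_mul_cancel₀ hv0, mul_one]
  rw [← ENNReal.pow_le_pow_left_iff two_ne_zero, mul_pow, sq_eLpNorm_two, sq_eLpNorm_two]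
  calc ∫⁻ x, ‖φ x - (volume.real A)⁻¹ * ∫ y in A, φ y‖ₑ ^ 2 ∂ν
      ≤ ∫⁻ x, (v⁻¹ : NNReal) * (∫⁻ y in A, ‖φ x - φ y‖ₑ ^ 2) ∂ν := lintegral_mono hpt
    _ = (v⁻¹ : NNReal) * sqDiff ν (volume.restrict A) φ :=
        lintegral_const_mul _ (measurable_lintegral_enorm_sub_sq hφ.continuous _)
    _ ≤ (v⁻¹ : NNReal) * (C * sqEnergy Ω φ) := by
        gcongr
        exact hC φ hφ
    _ ≤ ((v⁻¹ * C + 1 : NNReal) : ENNReal) ^ 2 * sqEnergy Ω φ := by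
        rw [← mul_assoc, ← ENNReal.coe_mul, ← ENNReal.coe_pow]
        refine mul_le_mul' (ENNReal.coe_le_coe.2 ?_) le_rfl
        nlinarith [zero_le (a := v⁻¹ * C), sq_nonneg (v⁻¹ * C)]

/-- With the mean written as a continuous functional on `L²(Ω)`, both sides are continuous in `f`,
`g`, `G`, so the estimate survives limits of smooth triples. -/
theorem PoincareRel.norm_sub_mean_le {Ω A : Set (Space n)} {ν : Measure (Space n)}
    [IsFiniteMeasure ν] (hb : Bornology.IsBounded A) (hA : MeasurableSet A) (h0 : volume A ≠ 0)
    (hAΩ : A ⊆ Ω) (hA' : volume.restrict Ω A ≠ ⊤)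
    (h : PoincareRel Ω ν (volume.restrict A)) :
    ∃ C : NNReal, ∀ φ : Space n → ℝ, ContDiff ℝ ∞ φ →
      ∀ (f : Lp ℝ 2 (volume.restrict Ω)) (g : Lp ℝ 2 ν) (G : Lp (Space n) 2 (volume.restrict Ω)),
        f =ᵐ[volume.restrict Ω] φ → g =ᵐ[ν] φ → G =ᵐ[volume.restrict Ω] gradient φ →
        ‖g - Lp.constL 2 ν ℝ (meanL2 (volume.restrict Ω) hA hA' f)‖ ≤ C * ‖G‖ := by
  obtain ⟨C, hC⟩ := h.eLpNorm_sub_mean_le hb hA h0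
  refine ⟨C, fun φ hφ f g G hf hg hG => ?_⟩
  have hr : (volume.restrict Ω).restrict A = volume.restrict A := by
    rw [Measure.restrict_restrict hA, Set.inter_eq_self_of_subset_left hAΩ]
  have hr2 : (volume.restrict Ω).real A = volume.real A := by
    rw [measureReal_def, Measure.restrict_apply hA, Set.inter_eq_self_of_subset_left hAΩ,
      measureReal_def]
  have hm : meanL2 (volume.restrict Ω) hA hA' f = (volume.real A)⁻¹ * ∫ y in A, φ y := by
    rw [meanL2_apply, hr2]
    congr 1
    rw [integral_congr_ae (ae_restrict_of_ae hf), hr]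
  rw [hm, Lp.norm_def, Lp.norm_def]
  have e1 : eLpNorm (g - Lp.constL 2 ν ℝ ((volume.real A)⁻¹ * ∫ y in A, φ y)) 2 ν =
      eLpNorm (fun x => φ x - (volume.real A)⁻¹ * ∫ y in A, φ y) 2 ν := by
    refine eLpNorm_congr_ae ?_
    filter_upwards [Lp.coeFn_sub g (Lp.constL 2 ν ℝ ((volume.real A)⁻¹ * ∫ y in A, φ y)), hg,
      Lp.coeFn_const (p := 2) (μ := ν) ((volume.real A)⁻¹ * ∫ y in A, φ y)] with x h1 h2 h3
    rw [h1, Pi.sub_apply, h2, Lp.constL_apply, h3]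
    rfl
  have e2 : eLpNorm G 2 (volume.restrict Ω) = eLpNorm (gradient φ) 2 (volume.restrict Ω) :=
    eLpNorm_congr_ae hG
  rw [e1, ← ENNReal.coe_toReal, ← ENNReal.toReal_mul]
  refine ENNReal.toReal_mono (ENNReal.mul_ne_top ENNReal.coe_ne_top (Lp.eLpNorm_ne_top _)) ?_
  rw [e2]
  exact hC φ hφ

theorem IsBoundedLipschitzDomain.exists_ball_subset {Ω : Set (Space n)}
    (hΩ : IsBoundedLipschitzDomain Ω) : ∃ x, ∃ r > 0, Metric.ball x r ⊆ Ω := by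
  obtain ⟨x, hx⟩ := hΩ.isConnected.nonempty
  obtain ⟨r, hr, h⟩ := Metric.isOpen_iff.1 hΩ.isOpen x hx
  exact ⟨x, r, hr, h⟩

theorem IsBoundedLipschitzDomain.isFiniteMeasure_surfaceMeasure {k : ℕ} {Ω : Set (Space (k + 1))}
    (hΩ : IsBoundedLipschitzDomain Ω) : IsFiniteMeasure (surfaceMeasure Ω) := by
  obtain ⟨x, r, hr, h⟩ := hΩ.exists_ball_subset
  exact ⟨(hΩ.surface hr h).1⟩

/-- The Poincaré inequality and the trace inequality for the functions in `H¹(Ω)`. -/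
theorem IsBoundedLipschitzDomain.exists_mean {k : ℕ} {Ω : Set (Space (k + 1))}
    (hΩ : IsBoundedLipschitzDomain Ω) [IsFiniteMeasure (volume.restrict Ω)]
    [IsFiniteMeasure (surfaceMeasure Ω)] :
    ∃ (M : Lp ℝ 2 (volume.restrict Ω) →L[ℝ] ℝ) (C : NNReal), (∀ a, M (Lp.const 2 _ a) = a) ∧
      ∀ x ∈ traceSpace Ω, ‖x.1 - Lp.constL 2 _ ℝ (M x.1)‖ ≤ C * ‖x.2.2‖ ∧
        ‖x.2.1 - Lp.constL 2 _ ℝ (M x.1)‖ ≤ C * ‖x.2.2‖ := by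
  obtain ⟨x₀, r, hr, h⟩ := hΩ.exists_ball_subset
  have hpos : volume (Metric.ball x₀ r) ≠ 0 := (Metric.measure_ball_pos volume x₀ hr).ne'
  have htop : volume.restrict Ω (Metric.ball x₀ r) ≠ ⊤ := measure_ne_top _ _
  have hpos' : volume.restrict Ω (Metric.ball x₀ r) ≠ 0 := by
    rwa [Measure.restrict_apply measurableSet_ball, Set.inter_eq_self_of_subset_left h]
  obtain ⟨C₁, h₁⟩ := (hΩ.poincareRel_volume hr h).norm_sub_mean_le Metric.isBounded_ball
    measurableSet_ball hpos h htop
  obtain ⟨C₂, h₂⟩ := (hΩ.surface hr h).2.norm_sub_mean_le Metric.isBounded_ball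
    measurableSet_ball hpos h htop
  set M := meanL2 (volume.restrict Ω) measurableSet_ball htop with hM
  refine ⟨M, max C₁ C₂, fun a => ?_, fun x hx => ?_⟩
  · refine meanL2_eq_of_ae_eq _ _ _ hpos' (ae_restrict_of_ae ?_)
    exact Lp.coeFn_const (p := 2) (μ := volume.restrict Ω) a
  · let s : Set (TripleSpace Ω) := {x | ‖x.1 - Lp.constL 2 _ ℝ (M x.1)‖ ≤
      (max C₁ C₂ : NNReal) * ‖x.2.2‖} ∩
        {x | ‖x.2.1 - Lp.constL 2 _ ℝ (M x.1)‖ ≤ (max C₁ C₂ : NNReal) * ‖x.2.2‖}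
    have hs : IsClosed s := by
      exact IsClosed.inter (isClosed_le (by fun_prop) (by fun_prop))
        (isClosed_le (by fun_prop) (by fun_prop))
    have hsub : (smoothTriples Ω : Set (TripleSpace Ω)) ⊆ s := by
      rintro z ⟨φ, hφ, k1, k2, k3⟩
      refine ⟨(h₁ φ hφ z.1 z.1 z.2.2 k1 k1 k3).trans ?_, (h₂ φ hφ z.1 z.2.1 z.2.2 k1 k2 k3).trans ?_⟩
      · gcongr
        exact le_max_left _ _
      · gcongr
        exact le_max_right _ _
    exact closure_minimal hsub hs hx

end MeanValue

/-! ### The conductivity form and Lax-Milgram -/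

section ConductivityForm

variable {n : ℕ} {Ω : Set (Space n)} {σ : Space n → ℝ}

/-- Multiplication by a conductivity on `L²(Ω)ⁿ`. -/
def conductivityMul (hσ : IsConductivity Ω σ) :
    Lp (Space n) 2 (volume.restrict Ω) →L[ℝ] Lp (Space n) 2 (volume.restrict Ω) :=
  (ContinuousLinearMap.lsmul ℝ ℝ).holderL (volume.restrict Ω) ⊤ 2 2 hσ.1.toLp

theorem inner_conductivityMul (hσ : IsConductivity Ω σ)
    (G H : Lp (Space n) 2 (volume.restrict Ω)) :
    inner ℝ (conductivityMul hσ G) H = ∫ x in Ω, σ x * inner ℝ (G x) (H x) := by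
  rw [L2.inner_def]
  refine integral_congr_ae ?_
  filter_upwards [hσ.1.coeFn_toLp,
    (ContinuousLinearMap.lsmul ℝ ℝ).coeFn_holder (r := 2) hσ.1.toLp G] with x h1 h2
  have : conductivityMul hσ G x = σ x • G x := by
    rw [← h1]; exact h2
  rw [this, real_inner_smul_left]

theorem integrable_conductivity_mul (hσ : IsConductivity Ω σ) {G H : Space n → Space n}
    (hG : MemLp G 2 (volume.restrict Ω)) (hH : MemLp H 2 (volume.restrict Ω)) :
    Integrable (fun x => σ x * inner ℝ (G x) (H x)) (volume.restrict Ω) := by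
  have h1 : MemLp (σ • G) 2 (volume.restrict Ω) := hG.smul hσ.1
  have h2 := L2.integrable_inner (𝕜 := ℝ) h1.toLp hH.toLp
  refine h2.congr ?_
  filter_upwards [h1.coeFn_toLp, hH.coeFn_toLp] with x k1 k2
  rw [k1, k2, Pi.smul_apply', real_inner_smul_left]

theorem exists_conductivity_lower_bound (hσ : IsConductivity Ω σ) : ∃ c : ℝ, 0 < c ∧
    ∀ G : Space n → Space n, MemLp G 2 (volume.restrict Ω) →
      c * ∫ x in Ω, inner ℝ (G x) (G x) ≤ ∫ x in Ω, σ x * inner ℝ (G x) (G x) := by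
  obtain ⟨c, hc, h⟩ := hσ.2
  refine ⟨c, hc, fun G hG => ?_⟩
  rw [← integral_const_mul]
  have hi : Integrable (fun x => inner ℝ (G x) (G x)) (volume.restrict Ω) := by
    refine (L2.integrable_inner (𝕜 := ℝ) hG.toLp hG.toLp).congr ?_
    filter_upwards [hG.coeFn_toLp] with x k
    rw [k]
  refine integral_mono_ae (hi.const_mul c) (integrable_conductivity_mul hσ hG hG) ?_
  filter_upwards [h] with x hx
  exact mul_le_mul_of_nonneg_right hx real_inner_self_nonneg

theorem exists_coercive_conductivityMul (hσ : IsConductivity Ω σ) : ∃ c : ℝ, 0 < c ∧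
    ∀ G : Lp (Space n) 2 (volume.restrict Ω),
      c * ‖G‖ * ‖G‖ ≤ inner ℝ (conductivityMul hσ G) G := by
  obtain ⟨c, hc, h⟩ := exists_conductivity_lower_bound hσ
  refine ⟨c, hc, fun G => ?_⟩
  rw [inner_conductivityMul, mul_assoc, ← real_inner_self_eq_norm_mul_norm, L2.inner_def]
  exact h G (Lp.memLp G)

/-- The Lax-Milgram theorem for the pull-back of a coercive form by an operator that is bounded
below. -/
theorem exists_forall_inner_eq {V H : Type*} [NormedAddCommGroup V] [NormedSpace ℝ V]
    [CompleteSpace V] [NormedAddCommGroup H] [InnerProductSpace ℝ H] [CompleteSpace H]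
    (A : H →L[ℝ] H) {c : ℝ} (hc : 0 < c) (hA : ∀ x, c * ‖x‖ * ‖x‖ ≤ inner ℝ (A x) x)
    (T : V →L[ℝ] H) {K : NNReal} (hT : ∀ x, ‖x‖ ≤ K * ‖T x‖) (ℓ : V →L[ℝ] ℝ) :
    ∃ x, ∀ y, inner ℝ (A (T x)) (T y) = ℓ y := by
  -- `V` is only a Banach space, so Lax-Milgram is applied on the range of `T`, which is closed
  -- because `T` is bounded below and is therefore a Hilbert space.
  have hanti := T.antilipschitz_of_bound hT
  have hrange : IsClosed (Set.range T) := hanti.isClosed_range T.uniformContinuous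
  let e := T.equivRange hanti.injective hrange
  have : CompleteSpace T.range := hrange.completeSpace_coe
  let B : T.range →L[ℝ] T.range →L[ℝ] ℝ := LinearMap.mkContinuous₂
    (LinearMap.mk₂ ℝ (fun G G' : T.range => (inner ℝ (A G) (G' : H) : ℝ))
      (fun G G' H => by simp only [Submodule.coe_add, map_add, inner_add_left])
      (fun a G H => by
        simp only [Submodule.coe_smul, map_smul, real_inner_smul_left, smul_eq_mul])
      (fun G H H' => by simp only [Submodule.coe_add, inner_add_right])
      (fun a G H => by simp only [Submodule.coe_smul, real_inner_smul_right, smul_eq_mul]))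
    ‖A‖ (fun G G' => by
      refine (norm_inner_le_norm (𝕜 := ℝ) (A G) (G' : H)).trans ?_
      exact mul_le_mul_of_nonneg_right (A.le_opNorm _) (norm_nonneg _))
  have hB : ∀ G G' : T.range, B G G' = inner ℝ (A G) (G' : H) := fun _ _ => rfl
  have hco : IsCoercive B := ⟨c, hc, fun G => hA G⟩
  set G := hco.continuousLinearEquivOfBilin.symm ((InnerProductSpace.toDual ℝ T.range).symm
    (ℓ.comp (e.symm : T.range →L[ℝ] V))) with hG
  obtain ⟨x, hx⟩ := G.2
  refine ⟨x, fun y => ?_⟩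
  have h1 : (T y : H) = (e y : T.range) := rfl
  have h2 : T x = G := hx
  rw [h1, h2, ← hB, ← hco.continuousLinearEquivOfBilin_apply, hG,
    ContinuousLinearEquiv.apply_symm_apply, InnerProductSpace.toDual_symm_apply,
    ContinuousLinearMap.comp_apply, ContinuousLinearEquiv.coe_coe,
    ContinuousLinearEquiv.symm_apply_apply]

end ConductivityForm

/-! ### Electrode potentials and existence of weak solutions -/

section ElectrodeSpace

variable {n m : ℕ} {Ω : Set (Space n)} {E : Fin m → Set (Space n)}
variable [IsFiniteMeasure (surfaceMeasure Ω)]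

/-- The mean boundary value on the electrode `E l`. -/
def voltage (hE : ∀ l, MeasurableSet (E l)) (l : Fin m) : Lp ℝ 2 (surfaceMeasure Ω) →L[ℝ] ℝ :=
  meanL2 (surfaceMeasure Ω) (hE l) (measure_ne_top _ _)

/-- The deviation of the boundary values from their mean value on the electrode `E l`. -/
def electrodeDefect (hE : ∀ l, MeasurableSet (E l)) (l : Fin m) :
    Lp ℝ 2 (surfaceMeasure Ω) →L[ℝ] Lp ℝ 2 ((surfaceMeasure Ω).restrict (E l)) :=
  LpToLpRestrictCLM _ ℝ ℝ (surfaceMeasure Ω) 2 (E l) -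
    (Lp.constL 2 ((surfaceMeasure Ω).restrict (E l)) ℝ).comp (voltage hE l)

/-- Constancy on an electrode becomes the kernel of a continuous operator, that is, a closed linear
condition. -/
theorem electrodeDefect_eq_zero_iff (hE : ∀ l, MeasurableSet (E l)) (l : Fin m)
    (g : Lp ℝ 2 (surfaceMeasure Ω)) : electrodeDefect hE l g = 0 ↔
      ∀ᵐ x ∂((surfaceMeasure Ω).restrict (E l)), g x = voltage hE l g := by
  have h1 := LpToLpRestrictCLM_coeFn ℝ (E l) g
  have h2 := Lp.coeFn_const (p := 2) (μ := (surfaceMeasure Ω).restrict (E l)) (voltage hE l g)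
  have e : electrodeDefect hE l g = LpToLpRestrictCLM _ ℝ ℝ (surfaceMeasure Ω) 2 (E l) g -
      Lp.const 2 _ (voltage hE l g) := rfl
  rw [e, sub_eq_zero, Lp.ext_iff]
  constructor
  · intro h
    filter_upwards [h, h1, h2] with x k k1 k2
    rw [← k1, k, k2]; rfl
  · intro h
    filter_upwards [h, h1, h2] with x k k1 k2
    rw [k1, k, k2]; rfl

/-- The triples of `H¹(Ω)`-functions that are constant on each electrode and are normalized by
the functional `M`. -/
def electrodeSpace (hE : ∀ l, MeasurableSet (E l)) (M : Lp ℝ 2 (volume.restrict Ω) →L[ℝ] ℝ) :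
    Submodule ℝ (TripleSpace Ω) :=
  traceSpace Ω ⊓ (M.comp (ContinuousLinearMap.fst ℝ _ _)).ker ⊓
    ⨅ l, ((electrodeDefect hE l).comp
      ((ContinuousLinearMap.fst ℝ _ _).comp (ContinuousLinearMap.snd ℝ _ _))).ker

variable {hE : ∀ l, MeasurableSet (E l)} {M : Lp ℝ 2 (volume.restrict Ω) →L[ℝ] ℝ}

theorem mem_electrodeSpace {x : TripleSpace Ω} : x ∈ electrodeSpace hE M ↔
    x ∈ traceSpace Ω ∧ M x.1 = 0 ∧ ∀ l, electrodeDefect hE l x.2.1 = 0 := by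
  simp [electrodeSpace, Submodule.mem_inf, and_assoc]

theorem voltage_eq (hE0 : ∀ l, surfaceMeasure Ω (E l) ≠ 0) {l : Fin m}
    {g : Lp ℝ 2 (surfaceMeasure Ω)} {c : ℝ}
    (h : ∀ᵐ x ∂((surfaceMeasure Ω).restrict (E l)), g x = c) : voltage hE l g = c :=
  meanL2_eq_of_ae_eq _ _ _ (hE0 l) h

theorem isClosed_electrodeSpace : IsClosed (electrodeSpace hE M : Set (TripleSpace Ω)) := by
  have h : (electrodeSpace hE M : Set (TripleSpace Ω)) = (traceSpace Ω : Set (TripleSpace Ω)) ∩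
      ({x | M x.1 = 0} ∩ ⋂ l, {x | electrodeDefect hE l x.2.1 = 0}) := by
    ext x
    simp [mem_electrodeSpace]
  rw [h]
  refine (Submodule.isClosed_topologicalClosure _).inter
    (IsClosed.inter (isClosed_eq (by fun_prop) continuous_const)
      (isClosed_iInter fun l => isClosed_eq (by fun_prop) continuous_const))

theorem isElectrodePotential_of_mem (hΩ : Bornology.IsBounded Ω) (hΩm : MeasurableSet Ω)
    {x : TripleSpace Ω} (hx : x ∈ electrodeSpace hE M) :
    IsElectrodePotential Ω E x.1 x.2.2 fun l => voltage hE l x.2.1 := by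
  rw [mem_electrodeSpace] at hx
  exact ⟨isH1_of_mem_traceSpace hΩ hΩm hx.1, x.2.1,
    (mem_traceSpace_iff hΩ hΩm inferInstance).1 hx.1,
    fun l => (electrodeDefect_eq_zero_iff hE l _).1 (hx.2.2 l)⟩

variable [IsFiniteMeasure (volume.restrict Ω)]

/-- Subtracting the constant `a = M w` normalizes a potential. The gradient is unchanged and all
voltages drop by `a`. -/
theorem IsElectrodePotential.exists_mem_electrodeSpace (hΩ : Bornology.IsBounded Ω)
    (hΩm : MeasurableSet Ω) (hE0 : ∀ l, surfaceMeasure Ω (E l) ≠ 0)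
    (hM : ∀ a, M (Lp.const 2 _ a) = a) {w : Space n → ℝ} {W : Space n → Space n} {d : Fin m → ℝ}
    (h : IsElectrodePotential Ω E w W d) :
    ∃ x ∈ electrodeSpace hE M, x.2.2 =ᵐ[volume.restrict Ω] W ∧
      ∃ a, ∀ l, voltage hE l x.2.1 = d l - a := by
  obtain ⟨hH, g, hg, hgd⟩ := h
  set a := M hH.memLp.toLp with ha
  have hmem := (hg.toLp_mem hΩ hΩm inferInstance hH.memLp hH.memLp_grad)
  have hval : ∀ l, ∀ᵐ x ∂((surfaceMeasure Ω).restrict (E l)),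
      (hg.1.toLp - Lp.const 2 (surfaceMeasure Ω) a : Lp ℝ 2 (surfaceMeasure Ω)) x = d l - a := by
    intro l
    filter_upwards [hgd l, ae_restrict_of_ae hg.1.coeFn_toLp,
      ae_restrict_of_ae (Lp.coeFn_sub hg.1.toLp (Lp.const 2 (surfaceMeasure Ω) a)),
      ae_restrict_of_ae (Lp.coeFn_const (p := 2) (μ := surfaceMeasure Ω) a)] with x h1 h2 h3 h4
    rw [h3, Pi.sub_apply, h2, h1, h4]; rfl
  have hvol : ∀ l, voltage hE l (hg.1.toLp - Lp.const 2 (surfaceMeasure Ω) a) = d l - a :=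
    fun l => voltage_eq hE0 (hval l)
  refine ⟨(hH.memLp.toLp - Lp.const 2 _ a, hg.1.toLp - Lp.const 2 _ a, hH.memLp_grad.toLp),
    ?_, hH.memLp_grad.coeFn_toLp, a, hvol⟩
  rw [mem_electrodeSpace]
  refine ⟨?_, ?_, fun l => ?_⟩
  · have := Submodule.sub_mem _ hmem (const_mem_traceSpace (Ω := Ω) a)
    simpa using this
  · simp only [map_sub, hM]
    rw [← ha, sub_self]
  · rw [electrodeDefect_eq_zero_iff, hvol l]
    exact hval l

/-- One Lax-Milgram argument serves both problems: the shunt model has `F = 0`, the source problem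
`I = 0`. On the normalized space the Poincaré and trace inequalities bound a triple by its gradient,
so the gradient map `T` is bounded below. -/
theorem exists_weak_solution {σ : Space n → ℝ} (hΩ : Bornology.IsBounded Ω)
    (hΩm : MeasurableSet Ω) (hσ : IsConductivity Ω σ) (hE : ∀ l, MeasurableSet (E l))
    (hE0 : ∀ l, surfaceMeasure Ω (E l) ≠ 0) {C : NNReal} (hM : ∀ a, M (Lp.const 2 _ a) = a)
    (hMC : ∀ x ∈ traceSpace Ω, ‖x.1 - Lp.constL 2 _ ℝ (M x.1)‖ ≤ C * ‖x.2.2‖ ∧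
        ‖x.2.1 - Lp.constL 2 _ ℝ (M x.1)‖ ≤ C * ‖x.2.2‖)
    {I : Fin m → ℝ} (hI : ∑ l, I l = 0) {F : Space n → Space n}
    (hF : MemLp F 2 (volume.restrict Ω)) :
    ∃ (u : Space n → ℝ) (G : Space n → Space n) (c : Fin m → ℝ),
      IsElectrodePotential Ω E u G c ∧
      ∀ (w : Space n → ℝ) (W : Space n → Space n) (d : Fin m → ℝ),
        IsElectrodePotential Ω E w W d →
          ∫ x in Ω, σ x * inner ℝ (G x) (W x) =
            ∑ l, I l * d l + ∫ x in Ω, inner ℝ (F x) (W x) := by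
  have hcl := isClosed_electrodeSpace (hE := hE) (M := M)
  have : CompleteSpace (electrodeSpace hE M) := hcl.completeSpace_coe
  let T : electrodeSpace hE M →L[ℝ] Lp (Space n) 2 (volume.restrict Ω) :=
    ((ContinuousLinearMap.snd ℝ _ _).comp (ContinuousLinearMap.snd ℝ _ _)).comp
      (electrodeSpace hE M).subtypeL
  have hT : ∀ x : electrodeSpace hE M, T x = x.1.2.2 := fun _ => rfl
  have hbound : ∀ x : electrodeSpace hE M, ‖x‖ ≤ (max C 1 : NNReal) * ‖T x‖ := by
    rintro ⟨x, hx⟩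
    rw [hT]
    have hx' := mem_electrodeSpace.1 hx
    obtain ⟨h1, h2⟩ := hMC x hx'.1
    rw [hx'.2.1, map_zero, sub_zero] at h1 h2
    change ‖x‖ ≤ _ * ‖x.2.2‖
    have k1 : (C : ℝ) * ‖x.2.2‖ ≤ (max C 1 : NNReal) * ‖x.2.2‖ := by
      gcongr
      exact le_max_left _ _
    have k2 : ‖x.2.2‖ ≤ (max C 1 : NNReal) * ‖x.2.2‖ := by
      refine le_mul_of_one_le_left (norm_nonneg _) ?_
      exact_mod_cast le_max_right C 1
    rw [Prod.norm_def, Prod.norm_def]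
    exact max_le (h1.trans k1) (max_le (h2.trans k1) k2)
  let ℓ : electrodeSpace hE M →L[ℝ] ℝ :=
    (∑ l, I l • (voltage hE l).comp
      ((ContinuousLinearMap.fst ℝ _ _).comp (ContinuousLinearMap.snd ℝ _ _))).comp
      (electrodeSpace hE M).subtypeL + (innerSL ℝ hF.toLp).comp T
  have hℓ : ∀ x : electrodeSpace hE M, ℓ x = ∑ l, I l * voltage hE l x.1.2.1 +
      inner ℝ hF.toLp x.1.2.2 := by
    intro x
    simp [ℓ, hT]
  obtain ⟨c, hc, hA⟩ := exists_coercive_conductivityMul hσ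
  obtain ⟨x, hx⟩ := exists_forall_inner_eq (conductivityMul hσ) hc hA T hbound ℓ
  refine ⟨x.1.1, x.1.2.2, _, isElectrodePotential_of_mem hΩ hΩm x.2, fun w W d hw => ?_⟩
  obtain ⟨y, hy, hyW, a, hya⟩ := hw.exists_mem_electrodeSpace (hE := hE) (M := M) hΩ hΩm hE0 hM
  have key := hx ⟨y, hy⟩
  rw [hℓ, hT, hT, inner_conductivityMul] at key
  have e1 : ∫ z in Ω, σ z * inner ℝ (x.1.2.2 z) (W z) =
      ∫ z in Ω, σ z * inner ℝ (x.1.2.2 z) (y.2.2 z) := by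
    refine integral_congr_ae ?_
    filter_upwards [hyW] with z hz
    rw [hz]
  have e2 : inner ℝ hF.toLp y.2.2 = ∫ z in Ω, inner ℝ (F z) (W z) := by
    rw [L2.inner_def]
    refine integral_congr_ae ?_
    filter_upwards [hyW, hF.coeFn_toLp] with z hz hz'
    rw [hz, hz']
  -- The common shift of the voltages drops out because the currents sum to zero.
  have e3 : ∑ l, I l * voltage hE l y.2.1 = ∑ l, I l * d l := by
    simp only [hya, mul_sub, Finset.sum_sub_distrib, ← Finset.sum_mul, hI, zero_mul, sub_zero]
  rw [e1, key, ← e2, ← e3]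

end ElectrodeSpace

/-! ### Gram matrices, pseudoinverses and minimal sources -/

section GramMatrix

variable {H : Type*} [NormedAddCommGroup H] [InnerProductSpace ℝ H] {m : ℕ}

/-- The matrix of the inner products of `F k` with `g j`. -/
def innerMatrix (g F : Fin m → H) : Matrix (Fin m) (Fin m) ℝ :=
  Matrix.of fun j k => inner ℝ (g j) (F k)

theorem objective_eq_sum (S W : Matrix (Fin m) (Fin m) ℝ) :
    objective S W = ∑ j, (W.transpose * (-(pinv S * W))) j j := by
  simp [objective, Matrix.mul_assoc]

/-- `Q` is the orthogonal projection onto the kernel of the symmetric Gram matrix `M`. By `hg` this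
kernel contains only constant vectors, so the rows of `Q` are constant and annihilate columns of sum
zero. The claim is `Q * W = 0`. -/
theorem mul_pinv_mul_of_column_sum {g : Fin m → H}
    (hg : ∀ a : Fin m → ℝ, ∑ j, a j • g j = 0 → ∀ i j, a i = a j)
    {W : Matrix (Fin m) (Fin m) ℝ} (hW : ∀ k, ∑ j, W j k = 0) :
    innerMatrix g g * (-(pinv (-innerMatrix g g) * W)) = W := by
  set M := innerMatrix g g with hM
  have hMt : M.transpose = M := by
    ext i j
    simp [hM, innerMatrix, real_inner_comm]
  have hp := pinv_isMoorePenrose (-M)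
  set X := pinv (-M) with hX
  set Q : Matrix (Fin m) (Fin m) ℝ := 1 - -M * X with hQ
  have hQt : Q.transpose = Q := by
    rw [hQ, Matrix.transpose_sub, Matrix.transpose_one, hp.symm_left]
  have hQM : Q * M = 0 := by
    have h1 : -M * X * M = M := by
      have := hp.mul_mul
      rw [Matrix.mul_neg] at this
      exact neg_injective this
    rw [hQ, Matrix.sub_mul, Matrix.one_mul, h1, sub_self]
  have hMQ : M * Q = 0 := by
    have := congrArg Matrix.transpose hQM
    rwa [Matrix.transpose_mul, hMt, hQt, Matrix.transpose_zero] at this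
  -- For a column `a` of `Q`, `M a = 0`, so `‖∑ a j • g j‖² = aᵀ M a = 0` and `hg` applies.
  have hcol : ∀ k i i', Q i k = Q i' k := by
    intro k
    refine hg (fun j => Q j k) ?_
    rw [← inner_self_eq_zero (𝕜 := ℝ), sum_inner]
    refine Finset.sum_eq_zero fun i _ => ?_
    rw [real_inner_smul_left, inner_sum]
    have : (M * Q) i k = 0 := by rw [hMQ]; rfl
    rw [Matrix.mul_apply] at this
    have h2 : ∑ j, inner ℝ (g i) (Q j k • g j) = ∑ j, M i j * Q j k := by
      refine Finset.sum_congr rfl fun j _ => ?_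
      rw [real_inner_smul_right, mul_comm]
      rfl
    rw [h2, this, mul_zero]
  have hrow : ∀ k i i', Q k i = Q k i' := by
    intro k i i'
    have h1 := hcol k i i'
    rw [← hQt] at h1
    exact h1
  have hQW : Q * W = 0 := by
    ext k j
    rw [Matrix.mul_apply, Matrix.zero_apply]
    calc ∑ i, Q k i * W i j = ∑ i, Q k k * W i j :=
          Finset.sum_congr rfl fun i _ => by rw [hrow k i k]
      _ = 0 := by rw [← Finset.mul_sum, hW, mul_zero]
  rw [hQ, Matrix.sub_mul, Matrix.one_mul, sub_eq_zero] at hQW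
  rw [Matrix.mul_neg, ← Matrix.mul_assoc, ← Matrix.neg_mul, ← Matrix.neg_mul]
  exact hQW.symm

/-- The quadratic functional of the pseudoinverse is the minimal norm of the sources that
produce a given matrix. -/
theorem exists_minimal_sources {g : Fin m → H}
    (hg : ∀ a : Fin m → ℝ, ∑ j, a j • g j = 0 → ∀ i j, a i = a j)
    {W : Matrix (Fin m) (Fin m) ℝ} (hW : ∀ k, ∑ j, W j k = 0) :
    ∃ F : Fin m → H, innerMatrix g F = W ∧
      objective (-innerMatrix g g) W = ∑ k, ‖F k‖ ^ 2 ∧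
      ∀ F' : Fin m → H, innerMatrix g F' = W → ∑ k, ‖F k‖ ^ 2 ≤ ∑ k, ‖F' k‖ ^ 2 := by
  set A := -(pinv (-innerMatrix g g) * W) with hA
  have hMA : innerMatrix g g * A = W := mul_pinv_mul_of_column_sum hg hW
  have hF : innerMatrix g (fun k => ∑ j, A j k • g j) = W := by
    rw [← hMA]
    ext i k
    simp [innerMatrix, Matrix.mul_apply, inner_sum, real_inner_smul_right, mul_comm]
  -- The inner product of the candidate with any sources producing `W` depends on `W` alone. Hence
  -- competitors differ from the candidate by an orthogonal vector, and the case of the candidate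
  -- itself gives the value of the functional.
  have hinner : ∀ (F' : Fin m → H), innerMatrix g F' = W → ∀ k,
      inner ℝ (∑ j, A j k • g j) (F' k) = (W.transpose * A) k k := by
    intro F' hF' k
    rw [sum_inner, Matrix.mul_apply]
    refine Finset.sum_congr rfl fun i _ => ?_
    rw [real_inner_smul_left, Matrix.transpose_apply, ← hF', mul_comm]
    rfl
  refine ⟨_, hF, ?_, fun F' hF' => Finset.sum_le_sum fun k _ => ?_⟩
  · rw [objective_eq_sum]
    refine Finset.sum_congr rfl fun k _ => ?_
    rw [← real_inner_self_eq_norm_sq]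
    exact (hinner _ hF k).symm
  · have h1 := hinner _ hF k
    have h2 := hinner _ hF' k
    have h3 := norm_sub_sq_real (F' k) (∑ j, A j k • g j)
    rw [real_inner_self_eq_norm_sq] at h1
    rw [real_inner_comm, h2, ← h1] at h3
    have h4 := sq_nonneg ‖F' k - ∑ j, A j k • g j‖
    linarith

/-- The admissible tuples form a nonempty closed convex subset of the Hilbert sum `PiLp 2`, and its
point closest to `0` is the minimizer. A second minimizer is excluded by the parallelogram law,
since the midpoint would be shorter. -/
theorem exists_unique_minimal_sources [CompleteSpace H] (g : Fin m → H)
    {K : Set (Matrix (Fin m) (Fin m) ℝ)} (hK : IsClosed K) (hKc : Convex ℝ K)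
    (hne : ∃ F, innerMatrix g F ∈ K) :
    ∃ F₀ : Fin m → H, innerMatrix g F₀ ∈ K ∧
      ∀ F : Fin m → H, innerMatrix g F ∈ K → ∑ k, ‖F₀ k‖ ^ 2 ≤ ∑ k, ‖F k‖ ^ 2 ∧
        (∑ k, ‖F k‖ ^ 2 ≤ ∑ k, ‖F₀ k‖ ^ 2 → F = F₀) := by
  let D : PiLp 2 (fun _ : Fin m => H) →ₗ[ℝ] Matrix (Fin m) (Fin m) ℝ :=
    { toFun := fun F => innerMatrix g F
      map_add' := fun F F' => by ext; simp [innerMatrix, inner_add_right]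
      map_smul' := fun a F => by ext; simp [innerMatrix, real_inner_smul_right] }
  have hD : Continuous D := by
    change Continuous fun F : PiLp 2 (fun _ : Fin m => H) => innerMatrix g F
    refine continuous_matrix fun i j => ?_
    change Continuous fun F : PiLp 2 (fun _ : Fin m => H) => inner ℝ (g i) (F j)
    fun_prop
  have hCc : Convex ℝ (D ⁻¹' K) := hKc.linear_preimage D
  obtain ⟨F₁, hF₁⟩ := hne
  obtain ⟨v, hv, hmin⟩ := exists_norm_eq_iInf_of_complete_convex (K := D ⁻¹' K)
    ⟨WithLp.toLp 2 F₁, hF₁⟩ (hK.preimage hD).isComplete hCc 0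
  have hle : ∀ w ∈ D ⁻¹' K, ‖v‖ ≤ ‖w‖ := by
    intro w hw
    rw [zero_sub, norm_neg] at hmin
    rw [hmin]
    have := ciInf_le (f := fun w : (D ⁻¹' K : Set _) => ‖(0 : PiLp 2 (fun _ : Fin m => H)) - w‖)
      ⟨0, by rintro _ ⟨w, rfl⟩; positivity⟩ ⟨w, hw⟩
    simpa using this
  have hn : ∀ w : PiLp 2 (fun _ : Fin m => H), ∑ k, ‖w k‖ ^ 2 = ‖w‖ ^ 2 := fun w =>
    (PiLp.norm_sq_eq_of_L2 _ w).symm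
  refine ⟨v, hv, fun F hF => ?_⟩
  set w : PiLp 2 (fun _ : Fin m => H) := WithLp.toLp 2 F with hw
  have hwF : ∑ k, ‖F k‖ ^ 2 = ‖w‖ ^ 2 := hn w
  have hwK : w ∈ D ⁻¹' K := hF
  rw [hn v, hwF]
  refine ⟨pow_le_pow_left₀ (norm_nonneg _) (hle w hwK) 2, fun h => ?_⟩
  have hmid : (1 / 2 : ℝ) • v + (1 / 2 : ℝ) • w ∈ D ⁻¹' K :=
    hCc hv hwK (by norm_num) (by norm_num) (by norm_num)
  have h1 := hle _ hmid
  rw [← smul_add, norm_smul] at h1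
  norm_num at h1
  have h2 := parallelogram_law_with_norm ℝ v w
  have h3 : ‖v - w‖ = 0 := by nlinarith [norm_nonneg v, norm_nonneg (v + w), norm_nonneg (v - w)]
  have h4 : v = w := sub_eq_zero.1 (norm_eq_zero.1 h3)
  rw [h4]

theorem constraints_isClosed [NeZero m] (V : Matrix (Fin m) (Fin m) ℝ) :
    IsClosed {W | Constraints V W} := by
  have h : {W | Constraints V W} = {W : Matrix (Fin m) (Fin m) ℝ |
      (∀ j k, CurrentFree j k → W j k = V j k) ∧ (∀ k, ∑ j, W j k = 0) ∧
        ∀ j, W j (j - 1) = W (j - 1) j} :=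
    Set.ext fun W => ⟨fun h => ⟨h.1, h.2, h.3⟩, fun h => ⟨h.1, h.2.1, h.2.2⟩⟩
  have hc : ∀ i j, Continuous fun W : Matrix (Fin m) (Fin m) ℝ => W i j := fun i j =>
    continuous_id.matrix_elem i j
  rw [h]
  simp only [Set.ofPred_and, Set.ofPred_forall]
  refine IsClosed.inter ?_ (IsClosed.inter ?_ ?_)
  · exact isClosed_iInter fun j => isClosed_iInter fun k => isClosed_iInter fun _ =>
      isClosed_eq (hc j k) continuous_const
  · exact isClosed_iInter fun k =>
      isClosed_eq (continuous_finsetSum _ fun j _ => hc j k) continuous_const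
  · exact isClosed_iInter fun j => isClosed_eq (hc _ _) (hc _ _)

theorem constraints_convex [NeZero m] (V : Matrix (Fin m) (Fin m) ℝ) :
    Convex ℝ {W | Constraints V W} := by
  intro W hW W' hW' a b _ _ hab
  refine ⟨fun j k hjk => ?_, fun k => ?_, fun j => ?_⟩
  · simp only [Matrix.add_apply, Matrix.smul_apply, smul_eq_mul, hW.interpolation j k hjk,
      hW'.interpolation j k hjk]
    rw [← add_mul, hab, one_mul]
  · simp only [Matrix.add_apply, Matrix.smul_apply, smul_eq_mul, Finset.sum_add_distrib,
      ← Finset.mul_sum, hW.column_sum, hW'.column_sum]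
    simp
  · simp only [Matrix.add_apply, Matrix.smul_apply, hW.symmetry j, hW'.symmetry j]

-- Keep the prescribed entries, put zero at the remaining off-diagonal places, and use the diagonal,
-- which no other constraint restricts, to correct the column sums.
open Classical in
theorem exists_constraints [NeZero m] (V : Matrix (Fin m) (Fin m) ℝ) : ∃ W, Constraints V W := by
  let f : Fin m → Fin m → ℝ := fun j k => if CurrentFree j k then V j k else 0
  have hf : ∀ k, f k k = 0 := fun k => if_neg fun h => h.1 rfl
  refine ⟨Matrix.of fun j k => if j = k then -∑ i, f i k else f j k, ?_, ?_, ?_⟩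
  · intro j k h
    simp [h.1, f, h]
  · intro k
    have : ∀ j, (Matrix.of fun j k => if j = k then -∑ i, f i k else f j k) j k =
        (if j = k then -∑ i, f i k else 0) + f j k := by
      intro j
      by_cases hj : j = k
      · subst hj; simp [hf]
      · simp [hj]
    simp only [this, Finset.sum_add_distrib]
    simp
  · intro j
    -- Equality occurs only for `m = 1`, where the symmetry condition is trivial.
    by_cases hj : j = j - 1
    · rw [← hj]
    · have h1 : f j (j - 1) = 0 := if_neg fun h => h.2.1 (by simp)
      have h2 : f (j - 1) j = 0 := if_neg fun h => h.2.2 (by simp)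
      simp [hj, Ne.symm hj, h1, h2]

end GramMatrix

/-! ### Unique continuation and the kernel of the Gram matrix -/

section Potentials

variable {n m : ℕ} {Ω : Set (Space n)} {E : Fin m → Set (Space n)}

theorem IsElectrodes.measurableSet (hE : IsElectrodes Ω E) (l : Fin m) : MeasurableSet (E l) := by
  obtain ⟨O, hO, h⟩ := hE.relatively_open l
  rw [h]
  exact hO.measurableSet.inter isClosed_frontier.measurableSet

theorem IsElectrodes.subset_frontier (hE : IsElectrodes Ω E) (l : Fin m) : E l ⊆ frontier Ω := by
  obtain ⟨O, hO, h⟩ := hE.relatively_open l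
  rw [h]
  exact Set.inter_subset_right

theorem IsElectrodes.surfaceMeasure_ne_zero {k : ℕ} {Ω : Set (Space (k + 1))}
    {E : Fin m → Set (Space (k + 1))} (hΩ : IsBoundedLipschitzDomain Ω) (hE : IsElectrodes Ω E)
    (l : Fin m) : surfaceMeasure Ω (E l) ≠ 0 := by
  obtain ⟨O, hO, h⟩ := hE.relatively_open l
  have hne := (hE.isConnected l).nonempty
  rw [h] at hne ⊢
  exact (hΩ.surfaceMeasure_pos hO hne).ne'

theorem IsH1.congr {u u' : Space n → ℝ} {G G' : Space n → Space n} (h : IsH1 Ω u G)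
    (hu : u =ᵐ[volume.restrict Ω] u') (hG : G =ᵐ[volume.restrict Ω] G') : IsH1 Ω u' G' := by
  refine ⟨h.memLp.ae_eq hu, h.memLp_grad.ae_eq hG, fun φ hφ hc hs => ?_⟩
  have e1 : ∫ x in Ω, u' x • gradient φ x = ∫ x in Ω, u x • gradient φ x :=
    integral_congr_ae (by filter_upwards [hu] with x hx; rw [hx])
  have e2 : ∫ x in Ω, φ x • G' x = ∫ x in Ω, φ x • G x :=
    integral_congr_ae (by filter_upwards [hG] with x hx; rw [hx])
  rw [e1, e2]
  exact h.weak_grad φ hφ hc hs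

theorem isElectrodePotential_of_contDiff (hΩ : Bornology.IsBounded Ω) (hΩm : MeasurableSet Ω)
    (hS : IsFiniteMeasure (surfaceMeasure Ω)) (hE : ∀ l, MeasurableSet (E l)) {φ : Space n → ℝ}
    (hφ : ContDiff ℝ ∞ φ) {d : Fin m → ℝ} (hd : ∀ l, ∀ x ∈ E l, φ x = d l) :
    IsElectrodePotential Ω E φ (gradient φ) d := by
  have m1 : MemLp φ 2 (volume.restrict Ω) :=
    memLp_volume_of_continuous hφ.continuous hΩ hΩm 2
  have m2 : MemLp (gradient φ) 2 (volume.restrict Ω) :=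
    memLp_volume_of_continuous (continuous_gradient hφ) hΩ hΩm 2
  have m3 : MemLp φ 2 (surfaceMeasure Ω) := memLp_surface_of_continuous hφ.continuous hΩ hS 2
  have hmem : ((m1.toLp, m3.toLp, m2.toLp) : TripleSpace Ω) ∈ traceSpace Ω :=
    Submodule.le_topologicalClosure _ ⟨φ, hφ, m1.coeFn_toLp, m3.coeFn_toLp, m2.coeFn_toLp⟩
  refine ⟨(isH1_of_mem_traceSpace hΩ hΩm hmem).congr m1.coeFn_toLp m2.coeFn_toLp, φ,
    ((mem_traceSpace_iff hΩ hΩm hS).1 hmem).congr m1.coeFn_toLp m2.coeFn_toLp m3.coeFn_toLp,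
    fun l => ?_⟩
  exact ae_restrict_of_forall_mem (hE l) (hd l)

theorem isElectrodePotential_of_tsupport_subset (hΩ : Bornology.IsBounded Ω) (hΩo : IsOpen Ω)
    (hS : IsFiniteMeasure (surfaceMeasure Ω)) (hE : IsElectrodes Ω E) {φ : Space n → ℝ}
    (hφ : ContDiff ℝ ∞ φ) (hs : tsupport φ ⊆ Ω) :
    IsElectrodePotential Ω E φ (gradient φ) 0 := by
  refine isElectrodePotential_of_contDiff hΩ hΩo.measurableSet hS hE.measurableSet hφ
    fun l x hx => ?_
  have h1 := hE.subset_frontier l hx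
  rw [hΩo.frontier_eq] at h1
  exact image_eq_zero_of_notMem_tsupport fun h => h1.2 (hs h)

/-- A smooth Urysohn function separates the closure of `E l` from the finite union of the other
closures. -/
theorem IsElectrodes.exists_unit_potential (hΩ : Bornology.IsBounded Ω) (hΩm : MeasurableSet Ω)
    (hS : IsFiniteMeasure (surfaceMeasure Ω)) (hE : IsElectrodes Ω E) (l : Fin m) :
    ∃ (w : Space n → ℝ) (W : Space n → Space n), IsElectrodePotential Ω E w W (Pi.single l 1) := by
  have hs : IsClosed (⋃ k : {k // k ≠ l}, closure (E k)) :=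
    isClosed_iUnion_of_finite fun _ => isClosed_closure
  have hd : Disjoint (⋃ k : {k // k ≠ l}, closure (E k)) (closure (E l)) :=
    Set.disjoint_iUnion_left.2 fun k => hE.disjoint k.2
  obtain ⟨f, h0, h1, _⟩ := exists_contMDiffMap_zero_one_of_isClosed (n := (⊤ : ℕ∞))
    (modelWithCornersSelf ℝ (Space n)) hs isClosed_closure hd
  refine ⟨f, gradient f, isElectrodePotential_of_contDiff hΩ hΩm hS hE.measurableSet
    f.contMDiff.contDiff fun k x hx => ?_⟩
  by_cases hk : k = l
  · subst hk
    rw [Pi.single_eq_same]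
    exact h1 (subset_closure hx)
  · rw [Pi.single_eq_of_ne hk]
    exact h0 (Set.mem_iUnion.2 ⟨⟨k, hk⟩, subset_closure hx⟩)

/-- The Poincaré inequality on the ball passes to the limit along the smooth approximations. Their
gradients tend to zero there, so `u` equals its mean. -/
theorem HasTrace.ae_eq_const_of_ball {u : Space n → ℝ} {G : Space n → Space n} {g : Space n → ℝ}
    (h : HasTrace Ω u G g) (hu : MemLp u 2 (volume.restrict Ω)) {x₀ : Space n} {r : ℝ} (hr : 0 < r)
    (hsub : Metric.ball x₀ r ⊆ Ω) (hG : ∀ᵐ x ∂(volume.restrict (Metric.ball x₀ r)), G x = 0) :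
    ∃ c : ℝ, ∀ᵐ x ∂(volume.restrict (Metric.ball x₀ r)), u x = c := by
  obtain ⟨_, φ, hφ, h1, h2, _⟩ := h
  set U := Metric.ball x₀ r with hU
  have hUb : Bornology.IsBounded U := Metric.isBounded_ball
  have hUm : MeasurableSet U := measurableSet_ball
  have hle : (volume.restrict U : Measure (Space n)) ≤ volume.restrict Ω :=
    Measure.restrict_mono hsub le_rfl
  have huU : MemLp u 2 (volume.restrict U) := hu.mono_measure hle
  have m1 : ∀ i, MemLp (φ i) 2 (volume.restrict U) := fun i =>
    memLp_volume_of_continuous (hφ i).continuous hUb hUm 2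
  have m2 : ∀ i, MemLp (gradient (φ i)) 2 (volume.restrict U) := fun i =>
    memLp_volume_of_continuous (continuous_gradient (hφ i)) hUb hUm 2
  have hpos : volume U ≠ 0 := (Metric.measure_ball_pos volume x₀ hr).ne'
  have htop : volume.restrict U U ≠ ⊤ := measure_ne_top _ _
  obtain ⟨C, hC⟩ := (PoincareRel.ball hUm (subset_refl U)).norm_sub_mean_le hUb hUm hpos
    subset_rfl htop
  have t1 : Tendsto (fun i => (m1 i).toLp) atTop (𝓝 huU.toLp) := by
    refine (Lp.tendsto_Lp_iff_tendsto_eLpNorm' _ _).2 ?_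
    refine tendsto_of_tendsto_of_tendsto_of_le_of_le tendsto_const_nhds h1
      (fun _ => zero_le) fun i => ?_
    refine (eLpNorm_congr_ae ((m1 i).coeFn_toLp.sub huU.coeFn_toLp)).trans_le ?_
    exact eLpNorm_mono_measure _ hle
  have t2 : Tendsto (fun i => (m2 i).toLp) atTop (𝓝 (0 : Lp (Space n) 2 (volume.restrict U))) := by
    refine (Lp.tendsto_Lp_iff_tendsto_eLpNorm' _ _).2 ?_
    refine tendsto_of_tendsto_of_tendsto_of_le_of_le tendsto_const_nhds h2
      (fun _ => zero_le) fun i => ?_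
    refine (eLpNorm_congr_ae ((m2 i).coeFn_toLp.sub ((Lp.coeFn_zero _ _ _).trans
      (EventuallyEq.symm hG)))).trans_le ?_
    exact eLpNorm_mono_measure _ hle
  set M := meanL2 (volume.restrict U) hUm htop with hM
  have hlim : ‖huU.toLp - Lp.constL 2 _ ℝ (M huU.toLp)‖ ≤
      C * ‖(0 : Lp (Space n) 2 (volume.restrict U))‖ := by
    refine le_of_tendsto_of_tendsto' (f := fun i => ‖(m1 i).toLp - Lp.constL 2 _ ℝ (M (m1 i).toLp)‖)
      ?_ (t2.norm.const_mul (C : ℝ)) fun i =>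
      hC (φ i) (hφ i) _ _ _ (m1 i).coeFn_toLp (m1 i).coeFn_toLp (m2 i).coeFn_toLp
    have hcont : Continuous fun f : Lp ℝ 2 (volume.restrict U) => ‖f - Lp.constL 2 _ ℝ (M f)‖ := by
      fun_prop
    exact (hcont.tendsto _).comp t1
  rw [norm_zero, mul_zero] at hlim
  have heq := sub_eq_zero.1 (norm_le_zero_iff.1 hlim)
  refine ⟨M huU.toLp, ?_⟩
  have h5 := Lp.ext_iff.1 heq
  filter_upwards [h5, huU.coeFn_toLp,
    Lp.coeFn_const (p := 2) (μ := volume.restrict U) (M huU.toLp)] with x k1 k2 k3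
  rw [← k2, k1, Lp.constL_apply, k3]
  rfl

theorem IsH1.grad_eq_zero_of_const (hΩ : Bornology.IsBounded Ω) (hΩo : IsOpen Ω)
    {u : Space n → ℝ} {G : Space n → Space n} (h : IsH1 Ω u G) {c : ℝ}
    (hu : ∀ᵐ x ∂(volume.restrict Ω), u x = c) : ∀ᵐ x ∂(volume.restrict Ω), G x = 0 := by
  have := isFiniteMeasure_restrict_of_isBounded hΩ
  have hG : IntegrableOn G Ω := h.memLp_grad.integrable one_le_two
  rw [ae_restrict_iff' hΩo.measurableSet]
  refine hΩo.ae_eq_zero_of_integral_contDiff_smul_eq_zero hG.locallyIntegrableOn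
    fun ψ hψ hc hs => ?_
  have e1 : ∫ x, ψ x • G x = ∫ x in Ω, ψ x • G x := by
    refine (setIntegral_eq_integral_of_forall_compl_eq_zero fun x hx => ?_).symm
    rw [image_eq_zero_of_notMem_tsupport fun h => hx (hs h), zero_smul]
  have e2 : ∫ x in Ω, u x • gradient ψ x = ∫ x in Ω, c • gradient ψ x :=
    integral_congr_ae (by filter_upwards [hu] with x hx; rw [hx])
  have mψ' : MemLp (gradient ψ) 2 (volume.restrict Ω) :=
    memLp_volume_of_continuous (continuous_gradient hψ) hΩ hΩo.measurableSet 2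
  have e3 : ∫ x in Ω, c • gradient ψ x = 0 := by
    refine ext_inner_left ℝ fun v => ?_
    have hi : Integrable (fun x => c • gradient ψ x) (volume.restrict Ω) :=
      (mψ'.integrable one_le_two).smul c
    rw [inner_zero_right, ← integral_inner hi]
    have := integral_mul_gradient_eq (φ := fun _ => c) contDiff_const hψ hc hs v
    rw [gradient_const_eq_zero] at this
    simpa [inner_smul_right, real_inner_comm] using this
  rw [e1, ← neg_eq_zero, ← h.weak_grad ψ hψ hc hs, e2, e3]

theorem coeFn_sum_smul_toLp {α F ι : Type*} [MeasurableSpace α] [NormedAddCommGroup F]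
    [NormedSpace ℝ F] {ν : Measure α} (s : Finset ι) (a : ι → ℝ) {f : ι → α → F}
    (hf : ∀ i, MemLp (f i) 2 ν) :
    (∑ i ∈ s, a i • (hf i).toLp : Lp F 2 ν) =ᵐ[ν] fun x => ∑ i ∈ s, a i • f i x := by
  classical
  induction s using Finset.induction_on with
  | empty => simp only [Finset.sum_empty]; exact Lp.coeFn_zero F 2 ν
  | insert i s hi ih =>
    rw [Finset.sum_insert hi]
    filter_upwards [Lp.coeFn_add (a i • (hf i).toLp) (∑ i ∈ s, a i • (hf i).toLp), ih,
      Lp.coeFn_smul (a i) (hf i).toLp, (hf i).coeFn_toLp] with x h1 h2 h3 h4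
    rw [h1, Pi.add_apply, h2, h3, Pi.smul_apply, h4, Finset.sum_insert hi]

/-- The current at electrode `l + 1` is `a (l + 1) - a l`, so consecutive coefficients agree. -/
theorem eq_of_sum_adjacentCurrent_eq_zero [NeZero m] {a : Fin m → ℝ}
    (h : ∀ l, ∑ k, a k * adjacentCurrent k l = 0) (i j : Fin m) : a i = a j := by
  have h1 : ∀ l, a (l + 1) = a l := by
    intro l
    have := h (l + 1)
    simp only [adjacentCurrent, mul_sub, Finset.sum_sub_distrib, mul_ite, mul_one, mul_zero,
      add_left_inj, Finset.sum_ite_eq', Finset.mem_univ, if_true] at this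
    linarith
  have h2 : ∀ (k : ℕ) (hk : k < m), a ⟨k, hk⟩ = a 0 := by
    intro k
    induction k with
    | zero => intro hk; rfl
    | succ k ih =>
      intro hk
      have : (⟨k + 1, hk⟩ : Fin m) = ⟨k, by omega⟩ + 1 := by
        refine Fin.ext ?_
        rw [Fin.val_add, Fin.val_one', Nat.add_mod_mod, Nat.mod_eq_of_lt hk]
      rw [this, h1, ih]
  rw [h2 i i.2, h2 j j.2]

/-- The combination `∑ a k • u k` has zero gradient on a ball in `B`, so it is constant there, hence
constant on `Ω` by unique continuation. A constant drives no current, so the combined currents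
vanish on every electrode. -/
theorem eq_of_sum_smul_grad_eq_zero [NeZero m] (hΩ : Bornology.IsBounded Ω) (hΩo : IsOpen Ω)
    (hS : IsFiniteMeasure (surfaceMeasure Ω)) (hE : IsElectrodes Ω E) {σ : Space n → ℝ}
    (hσ : IsConductivity Ω σ) (hucp : UCP Ω σ) {B : Set (Space n)}
    (hBint : (interior B).Nonempty) (hBΩ : B ⊆ Ω) {u : Fin m → Space n → ℝ}
    {G : Fin m → Space n → Space n} {c : Fin m → Fin m → ℝ}
    (hu : ∀ k, IsShuntSolution Ω E σ (adjacentCurrent k) (u k) (G k) (c k)) {a : Fin m → ℝ}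
    (ha : ∀ᵐ x ∂(volume.restrict B), ∑ k, a k • G k x = 0) (i j : Fin m) : a i = a j := by
  have hΩm := hΩo.measurableSet
  have mu : ∀ k, MemLp (u k) 2 (volume.restrict Ω) := fun k => (hu k).potential.isH1.memLp
  have mG : ∀ k, MemLp (G k) 2 (volume.restrict Ω) := fun k => (hu k).potential.isH1.memLp_grad
  choose g hg hgc using fun k => (hu k).potential.trace_const
  set x : TripleSpace Ω := ∑ k, a k • ((mu k).toLp, (hg k).1.toLp, (mG k).toLp) with hx
  have hxmem : x ∈ traceSpace Ω := Submodule.sum_mem _ fun k _ =>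
    Submodule.smul_mem _ _ ((hg k).toLp_mem hΩ hΩm hS (mu k) (mG k))
  have hx3 : x.2.2 = ∑ k, a k • (mG k).toLp := by
    rw [hx, Prod.snd_sum, Prod.snd_sum]
    rfl
  have hxG : x.2.2 =ᵐ[volume.restrict Ω] fun y => ∑ k, a k • G k y := by
    rw [hx3]
    exact coeFn_sum_smul_toLp _ _ mG
  have hH1 := isH1_of_mem_traceSpace hΩ hΩm hxmem
  have htr := (mem_traceSpace_iff hΩ hΩm hS).1 hxmem
  have hweak : ∀ (w : Space n → ℝ) (W : Space n → Space n) (d : Fin m → ℝ),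
      IsElectrodePotential Ω E w W d → ∫ y in Ω, σ y * inner ℝ (x.2.2 y) (W y) =
        ∑ k, a k * ∑ l, adjacentCurrent k l * d l := by
    intro w W d hw
    have mW := hw.isH1.memLp_grad
    have e : ∀ K : Space n → Space n, ∀ mK : MemLp K 2 (volume.restrict Ω),
        inner ℝ (conductivityMul hσ mK.toLp) mW.toLp = ∫ y in Ω, σ y * inner ℝ (K y) (W y) := by
      intro K mK
      rw [inner_conductivityMul]
      refine integral_congr_ae ?_
      filter_upwards [mK.coeFn_toLp, mW.coeFn_toLp] with y h1 h2
      rw [h1, h2]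
    rw [← e _ (Lp.memLp _), Lp.toLp_coeFn, hx3, map_sum, sum_inner]
    refine Finset.sum_congr rfl fun k _ => ?_
    rw [map_smul, real_inner_smul_left, e, (hu k).weak w W d hw]
  obtain ⟨z, hz⟩ := hBint
  obtain ⟨r, hr, hzr⟩ := Metric.isOpen_iff.1 isOpen_interior z hz
  have hrB : Metric.ball z r ⊆ B := hzr.trans interior_subset
  have hrΩ : Metric.ball z r ⊆ Ω := hrB.trans hBΩ
  have hG0 : ∀ᵐ y ∂(volume.restrict (Metric.ball z r)), x.2.2 y = 0 := by
    filter_upwards [ae_restrict_of_ae_restrict_of_subset hrB ha,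
      ae_restrict_of_ae_restrict_of_subset hrΩ hxG] with y h1 h2
    rw [h2, h1]
  have hconst := htr.ae_eq_const_of_ball (Lp.memLp _) hr hrΩ hG0
  obtain ⟨b, hb⟩ := hucp _ _ hH1 (fun φ hφ _ hs => by
    rw [hweak _ _ _ (isElectrodePotential_of_tsupport_subset hΩ hΩo hS hE hφ hs)]
    simp) (Metric.ball z r) Metric.isOpen_ball ⟨z, Metric.mem_ball_self hr⟩ hrΩ hconst
  have hG := hH1.grad_eq_zero_of_const hΩ hΩo hb
  refine eq_of_sum_adjacentCurrent_eq_zero (fun l => ?_) i j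
  -- Testing with a potential that is one on `E l` and zero on the other electrodes reads off the
  -- current through `E l`.
  obtain ⟨w, W, hw⟩ := hE.exists_unit_potential hΩ hΩm hS l
  have h1 := hweak w W _ hw
  have h2 : ∫ y in Ω, σ y * inner ℝ (x.2.2 y) (W y) = 0 := by
    refine integral_eq_zero_of_ae ?_
    filter_upwards [hG] with y hy
    rw [hy]; simp
  rw [h2] at h1
  rw [h1]
  simp [Pi.single_apply]

end Potentials

/-! ### Reciprocity and the geometric interpolant -/

section Measurements

variable {n m : ℕ} {Ω B : Set (Space n)} {E : Fin m → Set (Space n)} {σ : Space n → ℝ}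

theorem inner_toLp_eq_integral {f g : Space n → Space n} (hf : MemLp f 2 (volume.restrict B))
    (hg : MemLp g 2 (volume.restrict B)) :
    inner ℝ hf.toLp hg.toLp = ∫ x in B, inner ℝ (f x) (g x) := by
  rw [L2.inner_def]
  refine integral_congr_ae ?_
  filter_upwards [hf.coeFn_toLp, hg.coeFn_toLp] with x h1 h2
  rw [h1, h2]

theorem norm_toLp_sq_eq_integral {f : Space n → Space n} (hf : MemLp f 2 (volume.restrict B)) :
    ‖hf.toLp‖ ^ 2 = ∫ x in B, ‖f x‖ ^ 2 := by
  rw [← real_inner_self_eq_norm_sq, inner_toLp_eq_integral]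
  simp only [real_inner_self_eq_norm_sq]

/-- Reciprocity: each weak formulation is tested with the other solution. The two left sides agree
by symmetry, and the adjacent current pattern turns the boundary sum into a voltage difference. -/
theorem IsSourceSolution.voltage_difference [NeZero m] {F : Space n → Space n}
    {v : Space n → ℝ} {G : Space n → Space n} {c : Fin m → ℝ}
    (hv : IsSourceSolution Ω E σ B F v G c) {u : Space n → ℝ} {H : Space n → Space n}
    {d : Fin m → ℝ} {j : Fin m} (hu : IsShuntSolution Ω E σ (adjacentCurrent j) u H d) :
    c j - c (j + 1) = ∫ x in B, inner ℝ (H x) (F x) := by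
  have h1 := hv.weak _ _ _ hu.potential
  have h2 := hu.weak _ _ _ hv.potential
  simp only [real_inner_comm] at h1 h2 ⊢
  have h3 : ∑ l, adjacentCurrent j l * c l = c j - c (j + 1) := by
    simp [adjacentCurrent, sub_mul, Finset.sum_sub_distrib]
  exact h3.symm.trans (h2.symm.trans h1)

theorem summedSensitivity_eq {r : ℕ} {P : Fin r → Set (Space n)} (hP : IsPixelPartition Ω P)
    (hBΩ : B ⊆ Ω) (hBP : B = ⋃ (i : Fin r) (_ : P i ⊆ B), P i) {G : Fin m → Space n → Space n}
    (hG : ∀ k, MemLp (G k) 2 (volume.restrict B)) :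
    summedSensitivity Ω P B G =
      -innerMatrix (fun k => (hG k).toLp) (fun k => (hG k).toLp) := by
  classical
  ext j k
  have hBU : B = ⋃ i : {i // P i ⊆ B}, P i := by
    conv_lhs => rw [hBP]
    exact Set.biUnion_eq_iUnion {i | P i ⊆ B} fun i _ => P i
  have hint : Integrable (fun x => inner ℝ (G j x) (G k x)) (volume.restrict B) := by
    refine (L2.integrable_inner (𝕜 := ℝ) (hG j).toLp (hG k).toLp).congr ?_
    filter_upwards [(hG j).coeFn_toLp, (hG k).coeFn_toLp] with x h1 h2
    rw [h1, h2]
  have h1 : ∫ x in B, inner ℝ (G j x) (G k x) =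
      ∑ i : {i // P i ⊆ B}, ∫ x in P i, inner ℝ (G j x) (G k x) := by
    have h := integral_iUnion_ae (μ := volume) (s := fun i : {i // P i ⊆ B} => P i)
      (f := fun x => inner ℝ (G j x) (G k x))
      (fun i => (hP.measurableSet i).nullMeasurableSet)
      (fun i i' hii => hP.disjoint fun h => hii (Subtype.ext h))
      (by rw [← hBU]; exact hint)
    rw [← hBU, tsum_fintype] at h
    exact h
  have h2 : ∀ i : {i // P i ⊆ B}, P i ∩ Ω = P i := fun i =>
    Set.inter_eq_self_of_subset_left (i.2.trans hBΩ)
  rw [summedSensitivity, Matrix.sum_apply, Matrix.neg_apply]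
  simp only [innerMatrix, Matrix.of_apply, inner_toLp_eq_integral]
  rw [h1, ← Finset.sum_neg_distrib,
    Finset.sum_subtype _ (p := fun i => P i ⊆ B) (fun i => by simp)]
  refine Finset.sum_congr rfl fun i _ => ?_
  rw [pixelSensitivity, Matrix.of_apply, h2]

/-- By reciprocity the matrix is determined by the sources whichever solutions `v` are chosen;
solvability for every source gives the converse. -/
theorem isConsistent_iff [NeZero m]
    (hex : ∀ F : Space n → Space n, MemLp F 2 (volume.restrict B) →
      ∃ (v : Space n → ℝ) (G : Space n → Space n) (c : Fin m → ℝ), IsSourceSolution Ω E σ B F v G c)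
    {u : Fin m → Space n → ℝ} {G : Fin m → Space n → Space n} {c : Fin m → Fin m → ℝ}
    (hu : ∀ k, IsShuntSolution Ω E σ (adjacentCurrent k) (u k) (G k) (c k))
    (hG : ∀ k, MemLp (G k) 2 (volume.restrict B)) {V W : Matrix (Fin m) (Fin m) ℝ}
    {F : Fin m → Space n → Space n} (hF : ∀ k, MemLp (F k) 2 (volume.restrict B)) :
    IsConsistent Ω E σ B V F W ↔
      W = innerMatrix (fun k => (hG k).toLp) (fun k => (hF k).toLp) ∧ Constraints V W := by
  constructor
  · rintro ⟨_, hm, hc⟩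
    refine ⟨?_, hc⟩
    ext j k
    obtain ⟨v, K, d, hv, hW⟩ := hm k
    rw [hW, hv.voltage_difference (hu j), innerMatrix, Matrix.of_apply, inner_toLp_eq_integral]
  · rintro ⟨rfl, hc⟩
    refine ⟨hF, fun k => ?_, hc⟩
    obtain ⟨v, K, d, hv⟩ := hex (F k) (hF k)
    refine ⟨v, K, d, hv, fun j => ?_⟩
    rw [hv.voltage_difference (hu j), innerMatrix, Matrix.of_apply, inner_toLp_eq_integral]

theorem exists_geometricInterpolant [NeZero m] {r : ℕ} (hΩ : IsBoundedLipschitzDomain Ω)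
    (hS : IsFiniteMeasure (surfaceMeasure Ω)) (hE : IsElectrodes Ω E) (hσ : IsConductivity Ω σ)
    (hucp : UCP Ω σ) {P : Fin r → Set (Space n)} (hP : IsPixelPartition Ω P)
    (hBint : (interior B).Nonempty) (hBΩ : B ⊆ Ω)
    (hBP : B = ⋃ (i : Fin r) (_ : P i ⊆ B), P i)
    (hshunt : ∀ k, ∃ (u : Space n → ℝ) (G : Space n → Space n) (c : Fin m → ℝ),
      IsShuntSolution Ω E σ (adjacentCurrent k) u G c)
    (hsource : ∀ F : Space n → Space n, MemLp F 2 (volume.restrict B) →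
      ∃ (v : Space n → ℝ) (G : Space n → Space n) (c : Fin m → ℝ), IsSourceSolution Ω E σ B F v G c)
    (V : Matrix (Fin m) (Fin m) ℝ) :
    ∃ Vgeom : Matrix (Fin m) (Fin m) ℝ,
      IsGeometricInterpolant Ω E σ B V Vgeom ∧
      (∀ W, IsGeometricInterpolant Ω E σ B V W → W = Vgeom) ∧
      Constraints V Vgeom ∧
      ∀ (u : Fin m → Space n → ℝ) (G : Fin m → Space n → Space n) (c : Fin m → Fin m → ℝ),
        (∀ k, IsShuntSolution Ω E σ (adjacentCurrent k) (u k) (G k) (c k)) →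
        ∀ W, Constraints V W → W ≠ Vgeom →
          objective (summedSensitivity Ω P B G) Vgeom <
            objective (summedSensitivity Ω P B G) W := by
  have hmem : ∀ {u : Fin m → Space n → ℝ} {G : Fin m → Space n → Space n}
      {c : Fin m → Fin m → ℝ},
      (∀ k, IsShuntSolution Ω E σ (adjacentCurrent k) (u k) (G k) (c k)) →
      ∀ k, MemLp (G k) 2 (volume.restrict B) := fun hu k =>
    (hu k).potential.isH1.memLp_grad.mono_measure (Measure.restrict_mono hBΩ le_rfl)
  have hker : ∀ {u : Fin m → Space n → ℝ} {G : Fin m → Space n → Space n}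
      {c : Fin m → Fin m → ℝ}
      (hu : ∀ k, IsShuntSolution Ω E σ (adjacentCurrent k) (u k) (G k) (c k)),
      ∀ a : Fin m → ℝ, ∑ k, a k • (hmem hu k).toLp = 0 → ∀ i j, a i = a j := by
    intro u G c hu a ha
    refine eq_of_sum_smul_grad_eq_zero hΩ.isBounded hΩ.isOpen hS hE hσ hucp hBint hBΩ hu ?_
    have h1 := coeFn_sum_smul_toLp Finset.univ a (hmem hu)
    rw [ha] at h1
    exact h1.symm.trans (Lp.coeFn_zero _ _ _)
  choose u G c hu using hshunt
  have hG := hmem hu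
  set g : Fin m → Lp (Space n) 2 (volume.restrict B) := fun k => (hG k).toLp with hg
  obtain ⟨W₁, hW₁⟩ := exists_constraints V
  obtain ⟨F₁, hF₁, _⟩ := exists_minimal_sources (g := g) (hker hu) hW₁.column_sum
  obtain ⟨F₀, hF₀, hmin⟩ := exists_unique_minimal_sources g (constraints_isClosed V)
    (constraints_convex V) ⟨F₁, by rw [hF₁]; exact hW₁⟩
  have hF₀m : ∀ k, MemLp (F₀ k) 2 (volume.restrict B) := fun k => Lp.memLp _
  have hF₀L : (fun k => (hF₀m k).toLp) = F₀ := funext fun k => Lp.toLp_coeFn _ _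
  have hnorm₀ : ∑ k, ∫ x in B, ‖F₀ k x‖ ^ 2 = ∑ k, ‖F₀ k‖ ^ 2 :=
    Finset.sum_congr rfl fun k _ => by
      rw [← norm_toLp_sq_eq_integral (hF₀m k), Lp.toLp_coeFn]
  have hcons₀ : IsConsistent Ω E σ B V (fun k => F₀ k) (innerMatrix g F₀) := by
    rw [isConsistent_iff hsource hu hG hF₀m, hF₀L]
    exact ⟨rfl, hF₀⟩
  refine ⟨innerMatrix g F₀, ⟨fun k => F₀ k, hcons₀, fun F' W' h => ?_⟩, ?_, hF₀, ?_⟩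
  · have hF' := h.memLp
    obtain ⟨rfl, hc⟩ := (isConsistent_iff hsource hu hG hF').1 h
    have := (hmin _ hc).1
    simp only [norm_toLp_sq_eq_integral] at this
    rwa [hnorm₀]
  · rintro W ⟨F, hF, hFmin⟩
    have hFm := hF.memLp
    obtain ⟨rfl, hc⟩ := (isConsistent_iff hsource hu hG hFm).1 hF
    have h1 := hFmin _ _ hcons₀
    rw [hnorm₀] at h1
    have h2 := (hmin _ hc).2
    simp only [norm_toLp_sq_eq_integral] at h2
    rw [h2 h1]
  · intro u' G' c' hu' W hW hne
    have hG' := hmem hu'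
    -- The sensitivity matrix may be built from other shunt solutions. Reciprocity fixes the inner
    -- product of their gradients with every `F` in `L²(B)ⁿ`, so the gradients agree on `B`.
    have hgeq : (fun k => (hG' k).toLp) = g := by
      funext k
      refine ext_inner_right ℝ fun F => ?_
      obtain ⟨v, K, d, hv⟩ := hsource F (Lp.memLp F)
      have h1 := hv.voltage_difference (hu k)
      have h2 := hv.voltage_difference (hu' k)
      rw [← Lp.toLp_coeFn F (Lp.memLp F), hg, inner_toLp_eq_integral, inner_toLp_eq_integral,
        ← h1, ← h2]
    have hS : summedSensitivity Ω P B G' = -innerMatrix g g := by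
      rw [summedSensitivity_eq hP hBΩ hBP hG', hgeq]
    rw [hS]
    obtain ⟨F, hF, hFo, _⟩ := exists_minimal_sources (g := g) (hker hu) hW.column_sum
    obtain ⟨Fv, hFv, hFvo, hFvmin⟩ := exists_minimal_sources (g := g) (hker hu)
      (W := innerMatrix g F₀) (Constraints.column_sum hF₀)
    -- If `W` does no worse, its minimal sources have norm at most that of the minimal sources for
    -- `innerMatrix g F₀`, hence at most that of `F₀`. Uniqueness of `F₀` then identifies the
    -- sources and the matrices.
    by_contra! hle
    rw [hFo, hFvo] at hle
    refine hne ?_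
    have h1 : F = F₀ := (hmin F (by rw [hF]; exact hW)).2 (hle.trans (hFvmin F₀ rfl))
    rw [← hF, h1]

end Measurements

/-! ### Solvability of the shunt and source problems -/

section Existence

variable {k m : ℕ} {Ω B : Set (Space (k + 1))} {E : Fin m → Set (Space (k + 1))}
  {σ : Space (k + 1) → ℝ}

theorem exists_isShuntSolution (hΩ : IsBoundedLipschitzDomain Ω) (hE : IsElectrodes Ω E)
    (hσ : IsConductivity Ω σ) {I : Fin m → ℝ} (hI : ∑ l, I l = 0) :
    ∃ u G c, IsShuntSolution Ω E σ I u G c := by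
  have := isFiniteMeasure_restrict_of_isBounded hΩ.isBounded
  have := hΩ.isFiniteMeasure_surfaceMeasure
  obtain ⟨M, C, hM, hMC⟩ := hΩ.exists_mean
  obtain ⟨u, G, c, hu, h⟩ := exists_weak_solution hΩ.isBounded hΩ.isOpen.measurableSet hσ
    hE.measurableSet (hE.surfaceMeasure_ne_zero hΩ) hM hMC hI (F := 0) MemLp.zero
  exact ⟨u, G, c, hu, fun w W d hw => by simpa using h w W d hw⟩

theorem exists_isSourceSolution (hΩ : IsBoundedLipschitzDomain Ω) (hE : IsElectrodes Ω E)
    (hσ : IsConductivity Ω σ) (hB : MeasurableSet B) (hBΩ : B ⊆ Ω)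
    {F : Space (k + 1) → Space (k + 1)} (hF : MemLp F 2 (volume.restrict B)) :
    ∃ v G c, IsSourceSolution Ω E σ B F v G c := by
  have := isFiniteMeasure_restrict_of_isBounded hΩ.isBounded
  have := hΩ.isFiniteMeasure_surfaceMeasure
  obtain ⟨M, C, hM, hMC⟩ := hΩ.exists_mean
  have hr : (volume.restrict Ω).restrict B = volume.restrict B := by
    rw [Measure.restrict_restrict hB, Set.inter_eq_self_of_subset_left hBΩ]
  have hF' : MemLp (B.indicator F) 2 (volume.restrict Ω) := by
    rwa [memLp_indicator_iff_restrict hB, hr]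
  obtain ⟨u, G, c, hu, h⟩ := exists_weak_solution hΩ.isBounded hΩ.isOpen.measurableSet hσ
    hE.measurableSet (hE.surfaceMeasure_ne_zero hΩ) hM hMC (I := 0) (by simp) hF'
  refine ⟨u, G, c, hu, fun w W d hw => ?_⟩
  rw [h w W d hw]
  have e : ∀ x, inner ℝ (B.indicator F x) (W x) = B.indicator (fun x => inner ℝ (F x) (W x)) x := by
    intro x
    by_cases hx : x ∈ B <;> simp [hx]
  simp only [e, Pi.zero_apply, zero_mul, Finset.sum_const_zero, zero_add]
  rw [integral_indicator hB, hr]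

theorem sum_adjacentCurrent [NeZero m] (j : Fin m) : ∑ l, adjacentCurrent j l = 0 := by
  simp [adjacentCurrent, Finset.sum_sub_distrib]

end Existence

end EIT

end
theorem theorem1 {n m r : ℕ} [NeZero m] (hn : 2 ≤ n)
    (Ω : Set (EIT.Space n)) (hΩ : EIT.IsBoundedLipschitzDomain Ω)
    (E : Fin m → Set (EIT.Space n)) (hE : EIT.IsElectrodes Ω E)
    (σ₀ : EIT.Space n → ℝ) (hσ₀ : EIT.IsConductivity Ω σ₀) (hucp : EIT.UCP Ω σ₀)
    (P : Fin r → Set (EIT.Space n)) (hP : EIT.IsPixelPartition Ω P)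
    (B : Set (EIT.Space n)) (hB : IsClosed B) (hBint : (interior B).Nonempty) (hBΩ : B ⊆ Ω)
    (hBP : B = ⋃ (i : Fin r) (_ : P i ⊆ B), P i)
    (V : Matrix (Fin m) (Fin m) ℝ) (hV : ∀ j k, EIT.CurrentFree j k → V j k = V k j) :
    (∀ k, ∃ (u : EIT.Space n → ℝ) (G : EIT.Space n → EIT.Space n) (c : Fin m → ℝ),
      EIT.IsShuntSolution Ω E σ₀ (EIT.adjacentCurrent k) u G c) ∧
    ∃ Vgeom : Matrix (Fin m) (Fin m) ℝ,
      EIT.IsGeometricInterpolant Ω E σ₀ B V Vgeom ∧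
      (∀ W, EIT.IsGeometricInterpolant Ω E σ₀ B V W → W = Vgeom) ∧
      EIT.Constraints V Vgeom ∧
      ∀ (u : Fin m → EIT.Space n → ℝ) (G : Fin m → EIT.Space n → EIT.Space n)
        (c : Fin m → Fin m → ℝ),
        (∀ k, EIT.IsShuntSolution Ω E σ₀ (EIT.adjacentCurrent k) (u k) (G k) (c k)) →
        ∀ W, EIT.Constraints V W → W ≠ Vgeom →
          EIT.objective (EIT.summedSensitivity Ω P B G) Vgeom <
            EIT.objective (EIT.summedSensitivity Ω P B G) W := by
  -- Writing `n = k + 1` gives the boundary charts the parameter space `Fin k → ℝ` and the surface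
  -- measure the dimension `k`.
  obtain ⟨k, rfl⟩ : ∃ k, n = k + 1 := ⟨n - 1, by omega⟩
  have hshunt := fun j => EIT.exists_isShuntSolution hΩ hE hσ₀ (EIT.sum_adjacentCurrent j)
  exact ⟨hshunt, EIT.exists_geometricInterpolant hΩ hΩ.isFiniteMeasure_surfaceMeasure hE hσ₀ hucp
    hP hBint hBΩ hBP hshunt
    (fun _ hF => EIT.exists_isSourceSolution hΩ hE hσ₀ hB.measurableSet hBΩ hF) V⟩
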